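/- Let $R\subseteq\mathbb R^n\times\mathbb R^n$ be an equivalence relation on $\mathbb R^n$ which is a closed $C^\infty$ (embedded) submanifold of $\mathbb R^n\times\mathbb R^n$ and for which the first projection $R\to\mathbb R^n$ is a submersion. For $x\in\mathbb R^n$ let $R_x$ denote the equivalence class of $x$; it is a smooth submanifold of $\mathbb R^n$. For a smooth submanifold $M\subseteq\mathbb R^n$ let $N(M)=\{(x,v)\in\mathbb R^n\times\mathbb R^n : x\in M,\ v\perp T_xM\}$ be its normal bundle and let $\nu_M\colon N(M)\to\mathbb R^n$, $\nu_M(x,v)=x+v$. For $p\in\mathbb R^n$ let $V(R,p)$ be the set of all $x\in\mathbb R^n$ such that 1. $p-x$ is perpendicular to $T_xR_x$, i.e. $(x,p-x)\in N(R_x)$, and 2. $(x,p-x)$ is a regular point of $\nu_{R_x}\colon N(R_x)\to\mathbb R^n$, i.e. the differential $d_{(x,p-x)}\nu_{R_x}\colon T_{(x,p-x)}N(R_x)\to\mathbb R^n$ is surjective. Then for every $p\in\mathbb R^n$ the set $V(R,p)$ is an étale slice for $R$: it is a locally closed smooth submanifold of $\mathbb R^n$ and $$T_xV(R,p)\oplus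 T_xR_x=\mathbb R^n\qquad\text{for every }x\in V(R,p).$$ If moreover $R$ is a semialgebraic subset of $\mathbb R^{2n}$, then $V(R,p)$ is a semialgebraic subset of $\mathbb R^n$. (A subset of $\mathbb R^m$ is semialgebraic if it is a finite union of sets, each defined by finitely many polynomial equations $g=0$ and strict inequalities $h>0$.) -/

import Mathlib

open scoped ContDiff

namespace NormalSlices

section Submanifolds

variable {F G : Type*} [NormedAddCommGroup F] [NormedSpace ℝ F]
  [NormedAddCommGroup G] [NormedSpace ℝ G]

/-- `M` is an (embedded) `C^∞` submanifold of the vector space `F`: around each of its points a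
local `C^∞` diffeomorphism of the ambient space carries `M` to a linear subspace. -/
def IsSmoothSubmanifold (M : Set F) : Prop :=
  ∀ x ∈ M, ∃ (φ : OpenPartialHomeomorph F F) (L : Submodule ℝ F),
    x ∈ φ.source ∧ ContDiffOn ℝ ∞ φ φ.source ∧ ContDiffOn ℝ ∞ φ.symm φ.target ∧
      ∀ y ∈ φ.source, y ∈ M ↔ φ y ∈ L

/-- The tangent space `T_x M ⊆ F` of a submanifold `M ⊆ F` at a point `x` of `M`. It consists of
the limits of `c_k • (y_k - x)` with `c_k` real and `M ∋ y_k → x`. For a submanifold these limits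
already form a linear subspace, and the span makes this part of the type. -/
def tangentSpace (M : Set F) (x : F) : Submodule ℝ F :=
  Submodule.span ℝ (tangentConeAt ℝ M x)

/-- `z` is a regular point of the restriction to the submanifold `M ⊆ F` of the smooth map
`f : F → G`: the differential `d_z f : T_z M → G` is surjective. -/
def IsRegularPoint (f : F → G) (M : Set F) (z : F) : Prop :=
  Submodule.map (fderiv ℝ f z : F →ₗ[ℝ] G) (tangentSpace M z) = ⊤

end Submanifolds

section Relations

variable {X : Type*} [NormedAddCommGroup X] [NormedSpace ℝ X]

/-- An equivalence relation as a subset of `X × X`. -/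
def graph (R : Setoid X) : Set (X × X) := {z | R z.1 z.2}

/-- The equivalence class `R_x`. -/
def eqvClass (R : Setoid X) (x : X) : Set X := {y | R x y}

/-- `R` is a closed submersive equivalence relation on `X`: it is a closed submanifold of `X × X`,
and the first projection `R → X` is a submersion. -/
structure IsClosedSubmersive (R : Setoid X) : Prop where
  submanifold : IsSmoothSubmanifold (graph R)
  closed : IsClosed (graph R)
  submersive : ∀ z ∈ graph R, IsRegularPoint (Prod.fst : X × X → X) (graph R) z

/-- `Z` is an étale slice for `R`: a locally closed submanifold with `T_x Z ⊕ T_x R_x = T_x X` for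
all `x ∈ Z`. -/
structure IsEtaleSlice (R : Setoid X) (Z : Set X) : Prop where
  locallyClosed : IsLocallyClosed Z
  submanifold : IsSmoothSubmanifold Z
  isCompl : ∀ x ∈ Z, IsCompl (tangentSpace Z x) (tangentSpace (eqvClass R x) x)

end Relations

section Normals

variable {X : Type*} [NormedAddCommGroup X] [InnerProductSpace ℝ X]

/-- The normal bundle `N(M; X) = {(x, v) | x ∈ M, v ⟂ T_x M}` as a subset of `X × X`. -/
def normalBundle (M : Set X) : Set (X × X) := {z | z.1 ∈ M ∧ z.2 ∈ (tangentSpace M z.1)ᗮ}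

/-- The map `(x, v) ↦ x + v`, whose restriction to `N(M; X)` is the normal map `ν_M`. -/
def normalMap (z : X × X) : X := z.1 + z.2

/-- `V(R, p)`: the points `x` such that `p - x` is perpendicular to `T_x R_x` and `(x, p - x)`,
a point of `N(R_x; X)` over `p`, is a regular point of `ν_{R_x} : N(R_x; X) → X`. -/
def normalsSlice (R : Setoid X) (p : X) : Set X :=
  {x | p - x ∈ (tangentSpace (eqvClass R x) x)ᗮ ∧
    IsRegularPoint normalMap (normalBundle (eqvClass R x)) (x, p - x)}

end Normals

section Semialgebraic

/-- A finite system of polynomial equations and strict polynomial inequalities. -/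
def IsBasicSemialgebraic {ι : Type*} (S : Set (ι → ℝ)) : Prop :=
  ∃ P Q : Finset (MvPolynomial ι ℝ),
    S = {c | (∀ g ∈ P, MvPolynomial.eval c g = 0) ∧ ∀ h ∈ Q, 0 < MvPolynomial.eval c h}

/-- Semialgebraic subsets of `ℝ^ι`: finite unions of basic ones. -/
def IsSemialgebraic {ι : Type*} (S : Set (ι → ℝ)) : Prop :=
  ∃ A : Set (Set (ι → ℝ)), A.Finite ∧ (∀ B ∈ A, IsBasicSemialgebraic B) ∧ S = ⋃₀ A

variable {n : ℕ}

/-- A subset of Euclidean `n`-space, in coordinates. -/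
def coords (S : Set (EuclideanSpace ℝ (Fin n))) : Set (Fin n → ℝ) :=
  {c | WithLp.toLp 2 c ∈ S}

/-- A subset of `ℝ^n × ℝ^n`, in the `n + n` coordinates. -/
def coords₂ (S : Set (EuclideanSpace ℝ (Fin n) × EuclideanSpace ℝ (Fin n))) :
    Set (Fin n ⊕ Fin n → ℝ) :=
  {c | (WithLp.toLp 2 (fun i => c (Sum.inl i)), WithLp.toLp 2 (fun i => c (Sum.inr i))) ∈ S}

end Semialgebraic

end NormalSlices

/-! Slice property. Near a diagonal point `R` is the zero set of a submersion `F`, and submersivity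
of the first projection makes the differential `A x` of `F (x, ·)` at `x` surjective. Hence `T_x R_x
= ker (A x)`, with a smooth frame `B x` (`exists_localFrame`). Perpendicularity of `p - x` becomes
`τ x = 0`, where `τ = tangential p` pairs `p - x` with `B x`. The normal bundle of `R_x` is locally
the zero set of the submersion `G (y, v) = (F (x, y), ⟨v, B y ·⟩)`. The differential `dν` maps `ker
dG` onto the ambient space iff `ker dG + ker dν` is everything, iff `dG` maps `ker dν = {(η, -η)}`
onto its target; and `dG (η, -η) = (A x η, dτ η)`. So `x ∈ V(R, p)` iff `τ x = 0` and `(A x, dτ)` is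
surjective (`isRegularPoint_iff`), hence bijective by dimension. That condition is open, so `V(R,
p)` is locally the regular level set `τ = 0`, and its tangent space `ker dτ` is complementary to
`ker (A x)`.

Semialgebraicity. The tangent spaces involved coincide with tangent cones, which have an
ε-description quantifying only over reals and vectors. So `V(R, p)` is first-order definable from
`R`, and Tarski–Seidenberg (`SemialgebraicOver.exists_real`) applies. Its proof counts roots with
signs: the sum of `sign g` over the roots of `f` is the Cauchy index of `f' g / f`
(`cauchyIndex_derivative_mul`), which Euclidean division and reciprocity compute from finitely many
sign tests on coefficients. -/

namespace NormalSlices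

/-! ### Sign jumps of real polynomials and the Cauchy index. -/

section CauchyIndex

open Polynomial

/-- The value at `x` of the cofactor of the largest power of `X - x` dividing `P`. -/
noncomputable def cofactorAt (P : ℝ[X]) (x : ℝ) : ℝ :=
  (P /ₘ (X - C x) ^ P.rootMultiplicity x).eval x

/-- Half of the jump of the sign of `P` across `x`. -/
noncomputable def signJump (P : ℝ[X]) (x : ℝ) : ℤ :=
  if Even (P.rootMultiplicity x) then 0 else SignType.sign (cofactorAt P x)

lemma rootMultiplicity_of_eq_pow_mul {P Q : ℝ[X]} {x : ℝ} {m : ℕ}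
    (h : P = (X - C x) ^ m * Q) (hQ : Q.eval x ≠ 0) : P.rootMultiplicity x = m := by
  have hQ0 : Q ≠ 0 := by rintro rfl; simp at hQ
  have hX : (X - C x) ^ m ≠ 0 := pow_ne_zero _ (X_sub_C_ne_zero x)
  rw [h, rootMultiplicity_mul (mul_ne_zero hX hQ0), rootMultiplicity_X_sub_C_pow,
    rootMultiplicity_eq_zero hQ, add_zero]

lemma cofactorAt_of_eq_pow_mul {P Q : ℝ[X]} {x : ℝ} {m : ℕ}
    (h : P = (X - C x) ^ m * Q) (hQ : Q.eval x ≠ 0) : cofactorAt P x = Q.eval x := by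
  rw [cofactorAt, rootMultiplicity_of_eq_pow_mul h hQ, h,
    mul_divByMonic_cancel_left _ ((monic_X_sub_C x).pow m)]

lemma signJump_of_eq_pow_mul {P Q : ℝ[X]} {x : ℝ} {m : ℕ}
    (h : P = (X - C x) ^ m * Q) (hQ : Q.eval x ≠ 0) :
    signJump P x = if Even m then 0 else (SignType.sign (Q.eval x) : ℤ) := by
  rw [signJump, cofactorAt_of_eq_pow_mul h hQ, rootMultiplicity_of_eq_pow_mul h hQ]

lemma exists_eq_pow_mul {P : ℝ[X]} (hP : P ≠ 0) (x : ℝ) :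
    ∃ Q : ℝ[X], P = (X - C x) ^ P.rootMultiplicity x * Q ∧ Q.eval x ≠ 0 := by
  obtain ⟨Q, h, hQ⟩ := exists_eq_pow_rootMultiplicity_mul_and_not_dvd P hP x
  exact ⟨Q, h, fun h0 => hQ (dvd_iff_isRoot.2 h0)⟩

/-- A polynomial without roots in an interval has a constant sign there. -/
lemma sign_eval_eq_of_forall_ne_zero {P : ℝ[X]} {s : Set ℝ} (hs : s.OrdConnected)
    (h : ∀ x ∈ s, P.eval x ≠ 0) {a b : ℝ} (ha : a ∈ s) (hb : b ∈ s) :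
    SignType.sign (P.eval a) = SignType.sign (P.eval b) := by
  have key : ∀ u ∈ s, ∀ v ∈ s, P.eval u < 0 → ¬ 0 < P.eval v := by
    intro u hu v hv h1 h2
    have hc : IsPreconnected s := hs.isPreconnected
    obtain ⟨z, hz, hz0⟩ := hc.intermediate_value hu hv P.continuous.continuousOn
      (show (0 : ℝ) ∈ Set.Icc _ _ from ⟨h1.le, h2.le⟩)
    exact h z hz hz0
  rcases lt_or_gt_of_ne (h a ha) with h1 | h1 <;> rcases lt_or_gt_of_ne (h b hb) with h2 | h2
  · rw [sign_neg h1, sign_neg h2]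
  · exact absurd h2 (key a ha b hb h1)
  · exact absurd h1 (key b hb a ha h2)
  · rw [sign_pos h1, sign_pos h2]

/-- The cofactor of `(X - z) ^ m` keeps its sign on the interval, so only the parity of `m` decides
whether `P` changes sign. -/
lemma two_mul_signJump_eq {P : ℝ[X]} {a b z : ℝ} (haz : a < z) (hzb : z < b)
    (h : ∀ x ∈ Set.Icc a b, P.eval x = 0 → x = z) :
    2 * signJump P z = (SignType.sign (P.eval b) : ℤ) - SignType.sign (P.eval a) := by
  have hP : P ≠ 0 := by
    rintro rfl
    exact haz.ne (h a ⟨le_rfl, (haz.trans hzb).le⟩ (by simp))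
  obtain ⟨Q, hQ, hz⟩ := exists_eq_pow_mul hP z
  set m := P.rootMultiplicity z
  have hne : ∀ x ∈ Set.Icc a b, Q.eval x ≠ 0 := by
    intro x hx h0
    have : x = z := h x hx (by rw [hQ]; simp [h0])
    exact hz (this ▸ h0)
  have hsb := sign_eval_eq_of_forall_ne_zero Set.ordConnected_Icc hne
    (show z ∈ Set.Icc a b from ⟨haz.le, hzb.le⟩) (Set.right_mem_Icc.2 (haz.trans hzb).le)
  have hsa := sign_eval_eq_of_forall_ne_zero Set.ordConnected_Icc hne
    (show z ∈ Set.Icc a b from ⟨haz.le, hzb.le⟩) (Set.left_mem_Icc.2 (haz.trans hzb).le)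
  rw [signJump_of_eq_pow_mul hQ hz, hQ]
  have h1 : SignType.sign (b - z) = 1 := sign_pos (sub_pos.2 hzb)
  have h2 : SignType.sign (a - z) = -1 := sign_neg (sub_neg.2 haz)
  simp only [eval_mul, eval_pow, eval_sub, eval_X, eval_C, sign_mul, sign_pow, h1, h2, ← hsa,
    ← hsb, one_pow, one_mul]
  split_ifs with he
  · simp [he.neg_one_pow]
  · rw [Nat.not_even_iff_odd] at he
    rw [he.neg_one_pow]
    simp
    ring

lemma two_mul_sum_signJump {P : ℝ[X]} (hP : P ≠ 0) (a : ℝ) : ∀ (b : ℝ), a < b → P.eval a ≠ 0 →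
    P.eval b ≠ 0 → 2 * ∑ x ∈ P.roots.toFinset with a < x ∧ x < b, signJump P x =
      (SignType.sign (P.eval b) : ℤ) - SignType.sign (P.eval a) := by
  suffices H : ∀ (k : ℕ) (b : ℝ), (P.roots.toFinset.filter (fun x => a < x ∧ x < b)).card = k →
      a < b → P.eval a ≠ 0 → P.eval b ≠ 0 →
      2 * ∑ x ∈ P.roots.toFinset with a < x ∧ x < b, signJump P x =
      (SignType.sign (P.eval b) : ℤ) - SignType.sign (P.eval a) from fun b => H _ b rfl
  intro k
  induction k with
  | zero =>
    intro b hk hab ha hb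
    have he := Finset.card_eq_zero.1 hk
    rw [he, Finset.sum_empty, mul_zero, eq_comm, sub_eq_zero]
    congr 1
    refine sign_eval_eq_of_forall_ne_zero (Set.ordConnected_Icc (a := a) (b := b)) ?_
      (Set.right_mem_Icc.2 hab.le) (Set.left_mem_Icc.2 hab.le)
    intro x hx h0
    rcases hx.1.eq_or_lt with rfl | h1
    · exact ha h0
    rcases hx.2.eq_or_lt with rfl | h2
    · exact hb h0
    have : x ∈ P.roots.toFinset.filter (fun x => a < x ∧ x < b) := by
      simp [hP, h0, h1, h2]
    simp [he] at this
  | succ k ih =>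
    intro b hk hab ha hb
    set Z := P.roots.toFinset.filter (fun x => a < x ∧ x < b) with hZ
    have hmem : ∀ x, x ∈ Z ↔ P.eval x = 0 ∧ a < x ∧ x < b := by
      intro x; simp [hZ, hP]
    have hne : Z.Nonempty := Finset.card_pos.1 (by omega)
    obtain ⟨z, hzZ, hzmax⟩ : ∃ z ∈ Z, ∀ x ∈ Z, x ≤ z :=
      ⟨Z.max' hne, Z.max'_mem hne, fun x hx => Z.le_max' x hx⟩
    have hz := (hmem z).1 hzZ
    -- The point `c` separates the largest root `z` from the others, so induction covers `(a, c)`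
    -- and `z` is the only root in `[c, b]`.
    obtain ⟨c, hc1, hc2⟩ : ∃ c, (a < c ∧ c < z) ∧ ∀ x ∈ Z.erase z, x < c := by
      rcases (Z.erase z).eq_empty_or_nonempty with h | h
      · obtain ⟨c, hc⟩ := exists_between hz.2.1
        exact ⟨c, hc, by simp [h]⟩
      · have hw := Finset.max'_mem _ h
        have hw' := Finset.mem_erase.1 hw
        obtain ⟨c, hc, hc'⟩ := exists_between (lt_of_le_of_ne (hzmax _ hw'.2) hw'.1)
        exact ⟨c, ⟨((hmem _).1 hw'.2).2.1.trans hc, hc'⟩,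
          fun x hx => (Finset.le_max' _ x hx).trans_lt hc⟩
    have hroot : ∀ x ∈ Set.Icc c b, P.eval x = 0 → x = z := by
      intro x hx h0
      by_contra hxz
      have hxb : x < b := lt_of_le_of_ne hx.2 (fun h => hb (h ▸ h0))
      exact absurd (hc2 x (Finset.mem_erase.2 ⟨hxz, (hmem x).2 ⟨h0, hc1.1.trans_le hx.1, hxb⟩⟩))
        (not_lt.2 hx.1)
    have hfe : P.roots.toFinset.filter (fun x => a < x ∧ x < c) = Z.erase z := by
      ext x
      rw [Finset.mem_erase, hmem]
      simp only [Finset.mem_filter, Multiset.mem_toFinset, mem_roots hP, IsRoot.def]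
      constructor
      · rintro ⟨h0, h1, h2⟩
        exact ⟨(h2.trans hc1.2).ne, h0, h1, (h2.trans hc1.2).trans hz.2.2⟩
      · rintro ⟨hxz, h0, h1, h2⟩
        exact ⟨h0, h1, hc2 x (Finset.mem_erase.2 ⟨hxz, (hmem x).2 ⟨h0, h1, h2⟩⟩)⟩
    have hcne : P.eval c ≠ 0 := fun h0 =>
      hc1.2.ne (hroot c ⟨le_rfl, (hc1.2.trans hz.2.2).le⟩ h0)
    have := ih c (by rw [hfe, Finset.card_erase_of_mem hzZ, hk]; rfl) hc1.1 ha hcne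
    rw [hfe] at this
    rw [← Finset.sum_erase_add _ _ hzZ, mul_add, this,
      two_mul_signJump_eq hc1.2 hz.2.2 hroot]
    ring

lemma eventually_sign_eval_atTop (P : ℝ[X]) :
    ∀ᶠ t in Filter.atTop, SignType.sign (P.eval t) = SignType.sign P.leadingCoeff := by
  rcases eq_or_ne P 0 with rfl | hP
  · simp
  have hl := leadingCoeff_ne_zero.2 hP
  have h1 := (Asymptotics.isEquivalent_iff_tendsto_one (by
    filter_upwards [Filter.eventually_gt_atTop (0 : ℝ)] with t ht
    positivity)).1 P.isEquivalent_atTop_lead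
  filter_upwards [h1.eventually (lt_mem_nhds zero_lt_one), Filter.eventually_gt_atTop (0 : ℝ)]
    with t ht ht0
  have h2 : P.eval t = (P.eval t / (P.leadingCoeff * t ^ P.natDegree)) *
    (P.leadingCoeff * t ^ P.natDegree) := by
    field_simp
  rw [h2, sign_mul, sign_mul, sign_pos (pow_pos ht0 _), mul_one]
  rw [show SignType.sign (P.eval t / (P.leadingCoeff * t ^ P.natDegree)) = 1 from sign_pos ht,
    one_mul]

lemma leadingCoeff_comp_neg_X (P : ℝ[X]) :
    (P.comp (-X)).leadingCoeff = (-1) ^ P.natDegree * P.leadingCoeff := by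
  rw [leadingCoeff_comp (by simp)]
  simp [mul_comm]

lemma eventually_sign_eval_neg_atTop (P : ℝ[X]) :
    ∀ᶠ t in Filter.atTop, SignType.sign (P.eval (-t)) =
      SignType.sign ((-1) ^ P.natDegree * P.leadingCoeff) := by
  have := eventually_sign_eval_atTop (P.comp (-X))
  rw [leadingCoeff_comp_neg_X] at this
  simpa using this

/-- Apply the interval version to `(-t, t)` with `t` so large that all roots lie inside and the end
signs are those at `±∞`. -/
lemma two_mul_sum_signJump_roots {P : ℝ[X]} (hP : P ≠ 0) :
    2 * ∑ x ∈ P.roots.toFinset, signJump P x =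
      (SignType.sign P.leadingCoeff : ℤ) - SignType.sign ((-1) ^ P.natDegree * P.leadingCoeff) := by
  have hl := leadingCoeff_ne_zero.2 hP
  have hfin : ∀ᶠ t in Filter.atTop, ∀ x ∈ P.roots.toFinset, -t < x ∧ x < t := by
    rw [Filter.eventually_all_finset]
    intro x _
    filter_upwards [Filter.eventually_gt_atTop x, Filter.eventually_gt_atTop (-x)] with t h1 h2
    exact ⟨by linarith, h1⟩
  obtain ⟨t, h1, h2, h3, h4⟩ := ((eventually_sign_eval_atTop P).and
    ((eventually_sign_eval_neg_atTop P).and (hfin.and (Filter.eventually_gt_atTop 0)))).exists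
  have e := two_mul_sum_signJump hP (-t) t (by linarith)
    (by rw [← sign_ne_zero, h2, sign_ne_zero]; exact mul_ne_zero (by simp) hl)
    (by rw [← sign_ne_zero, h1, sign_ne_zero]; exact hl)
  rw [Finset.filter_true_of_mem h3, h1, h2] at e
  exact e

open Classical in
/-- The Cauchy index of the rational function `h / f`. -/
noncomputable def cauchyIndex (h f : ℝ[X]) : ℤ :=
  ∑ x ∈ f.roots.toFinset,
    if (X - C x) ^ f.rootMultiplicity x ∣ h then 0 else signJump (h * f) x

/-- Division step: at a pole `h` vanishes to lower order than `f`, so adding `q * f` leaves the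
leading cofactor of `h` unchanged. -/
lemma cauchyIndex_congr {h h' f q : ℝ[X]} {a : ℝ} (ha : 0 < a) (e : h' = C a * h + q * f) :
    cauchyIndex h f = cauchyIndex h' f := by
  rcases eq_or_ne f 0 with rfl | hf
  · simp [cauchyIndex]
  refine Finset.sum_congr rfl fun x _ => ?_
  have hdf : (X - C x) ^ f.rootMultiplicity x ∣ f := pow_rootMultiplicity_dvd f x
  have hiff : (X - C x) ^ f.rootMultiplicity x ∣ h ↔ (X - C x) ^ f.rootMultiplicity x ∣ h' := by
    rw [e, dvd_add_left (hdf.mul_left q), IsUnit.dvd_mul_left (isUnit_C.2 ha.ne'.isUnit)]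
  by_cases hd : (X - C x) ^ f.rootMultiplicity x ∣ h
  · rw [if_pos hd, if_pos (hiff.1 hd)]
  rw [if_neg hd, if_neg (fun h => hd (hiff.2 h))]
  have h0 : h ≠ 0 := by rintro rfl; simp at hd
  rw [← le_rootMultiplicity_iff h0, not_le] at hd
  obtain ⟨Q, hQ, hQx⟩ := exists_eq_pow_mul h0 x
  obtain ⟨S, hS, hSx⟩ := exists_eq_pow_mul hf x
  set k := h.rootMultiplicity x
  set m := f.rootMultiplicity x
  have e1 : h * f = (X - C x) ^ (k + m) * (Q * S) := by rw [pow_add, hQ, hS]; ring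
  have e2 : h' * f = (X - C x) ^ (k + m) * ((C a * Q + q * ((X - C x) ^ (m - k) * S)) * S) := by
    have : f = (X - C x) ^ k * ((X - C x) ^ (m - k) * S) := by
      rw [← mul_assoc, ← pow_add, Nat.add_sub_cancel' hd.le]; exact hS
    rw [e]
    calc _ = (C a * ((X - C x) ^ k * Q) + q * ((X - C x) ^ k * ((X - C x) ^ (m - k) * S))) *
        ((X - C x) ^ m * S) := by rw [← hQ, ← this, ← hS]
      _ = _ := by rw [pow_add]; ring
  have e3 : eval x ((C a * Q + q * ((X - C x) ^ (m - k) * S)) * S) = a * eval x (Q * S) := by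
    have : m - k ≠ 0 := by omega
    simp [this]
    ring
  have hne : eval x (Q * S) ≠ 0 := by rw [eval_mul]; exact mul_ne_zero hQx hSx
  rw [signJump_of_eq_pow_mul e1 hne, signJump_of_eq_pow_mul e2 (by
    rw [e3]; exact mul_ne_zero ha.ne' hne), e3, sign_mul, sign_pos ha, one_mul]

/-- Reciprocity: at a root of `h * f` with unequal multiplicities exactly one of `h / f`, `f / h`
has a pole; with equal ones neither has, and `h * f` has even order there. The jumps thus add up to
those of `h * f`. -/
lemma two_mul_cauchyIndex_add {h f : ℝ[X]} (hh : h ≠ 0) (hf : f ≠ 0) :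
    2 * (cauchyIndex h f + cauchyIndex f h) =
      (SignType.sign (h.leadingCoeff * f.leadingCoeff) : ℤ) -
        SignType.sign ((-1) ^ (h.natDegree + f.natDegree) *
          (h.leadingCoeff * f.leadingCoeff)) := by
  classical
  have hhf : h * f ≠ 0 := mul_ne_zero hh hf
  have key : ∀ {u v : ℝ[X]}, u ≠ 0 → v ≠ 0 → cauchyIndex u v = ∑ x ∈ (u * v).roots.toFinset,
      if (X - C x) ^ v.rootMultiplicity x ∣ u then 0 else signJump (u * v) x := by
    intro u v hu hv
    refine Eq.trans ?_ (Finset.sum_subset (s₁ := v.roots.toFinset) ?_ ?_)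
    · refine Finset.sum_congr rfl fun x _ => ?_
      congr
    · intro x hx
      rw [roots_mul (mul_ne_zero hu hv)]
      simp at hx ⊢
      tauto
    · intro x _ hx
      have : v.rootMultiplicity x = 0 := rootMultiplicity_eq_zero (by simpa [hv] using hx)
      simp [this]
  rw [key hh hf, key hf hh, mul_comm f h, ← Finset.sum_add_distrib, ← natDegree_mul hh hf,
    ← leadingCoeff_mul, ← two_mul_sum_signJump_roots hhf]
  congr 1
  refine Finset.sum_congr rfl fun x _ => ?_
  rw [← le_rootMultiplicity_iff hh, ← le_rootMultiplicity_iff hf]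
  rcases lt_trichotomy (h.rootMultiplicity x) (f.rootMultiplicity x) with hlt | heq | hlt
  · rw [if_neg (not_le.2 hlt), if_pos hlt.le, add_zero]
  · rw [if_pos heq.ge, if_pos heq.le, signJump, if_pos]
    · rfl
    · rw [rootMultiplicity_mul hhf, heq]; exact ⟨_, rfl⟩
  · rw [if_neg (not_le.2 hlt), if_pos hlt.le, zero_add]

/-- The logarithmic derivative `f' / f` has a simple pole with positive residue at each root, so
multiplying by `g` leaves the jump `sign (g x)`. -/
lemma cauchyIndex_derivative_mul (f g : ℝ[X]) :
    cauchyIndex (derivative f * g) f = ∑ x ∈ f.roots.toFinset, (SignType.sign (g.eval x) : ℤ) := by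
  rcases eq_or_ne f 0 with rfl | hf
  · simp [cauchyIndex]
  refine Finset.sum_congr rfl fun x hx => ?_
  have hroot : f.IsRoot x := by simpa [hf] using hx
  obtain ⟨S, hS, hSx⟩ := exists_eq_pow_mul hf x
  have hpos : 0 < f.rootMultiplicity x := (rootMultiplicity_pos hf).2 hroot
  obtain ⟨m, hm⟩ : ∃ m, f.rootMultiplicity x = m + 1 := ⟨_, (Nat.succ_pred_eq_of_pos hpos).symm⟩
  rw [hm] at hS ⊢
  have e1 : derivative f * g = (X - C x) ^ m *
      ((C ((m : ℝ) + 1) * S + (X - C x) * derivative S) * g) := by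
    rw [hS]
    simp [derivative_mul, derivative_X_sub_C_pow]
    ring
  by_cases hg : g.eval x = 0
  · rw [if_pos, hg]
    · simp
    · rw [e1, pow_succ]
      exact mul_dvd_mul_left _ ((dvd_iff_isRoot.2 hg).mul_left _)
  · have hm0 : (0 : ℝ) < m + 1 := by positivity
    have hT : eval x ((C ((m : ℝ) + 1) * S + (X - C x) * derivative S) * g) ≠ 0 := by
      simp only [eval_mul, eval_add, eval_C, eval_sub, eval_X, sub_self, zero_mul, add_zero]
      exact mul_ne_zero (mul_ne_zero hm0.ne' hSx) hg
    have hne : derivative f * g ≠ 0 := by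
      intro h
      rw [h, eq_comm, mul_eq_zero] at e1
      rcases e1 with h | h
      · exact pow_ne_zero _ (X_sub_C_ne_zero x) h
      · rw [h] at hT; simp at hT
    rw [if_neg]
    -- The order `2 * m + 1` is odd, and the cofactor at `x` is a positive multiple of `g x`.
    · have e2 : derivative f * g * f = (X - C x) ^ (2 * m + 1) *
          (((C ((m : ℝ) + 1) * S + (X - C x) * derivative S) * g) * S) := by
        rw [e1]
        conv_lhs => rw [hS]
        ring
      rw [signJump_of_eq_pow_mul e2 (by rw [eval_mul]; exact mul_ne_zero hT hSx),
        if_neg (by simp)]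
      congr 1
      have : eval x (((C ((m : ℝ) + 1) * S + (X - C x) * derivative S) * g) * S) =
          ((m + 1) * S.eval x ^ 2) * g.eval x := by
        simp; ring
      rw [this, sign_mul, sign_pos (by positivity), one_mul]
    · rw [← le_rootMultiplicity_iff hne, rootMultiplicity_of_eq_pow_mul e1 hT]
      omega

end CauchyIndex

/-! ### Boolean combinations of sign conditions and their normal form. -/

section BooleanClosure

variable {D : Type*} {T T' T'' : Type*}

/-- The Boolean algebra of sets generated by the sets `{f > 0}` with `f` in an algebra `A` of
real functions. -/
inductive SemialgebraicOver (A : Subalgebra ℝ (D → ℝ)) : Set D → Prop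
  | pos {f : D → ℝ} (hf : f ∈ A) : SemialgebraicOver A {d | 0 < f d}
  | compl {S : Set D} (hS : SemialgebraicOver A S) : SemialgebraicOver A Sᶜ
  | inter {S S' : Set D} (hS : SemialgebraicOver A S) (hS' : SemialgebraicOver A S') :
      SemialgebraicOver A (S ∩ S')

namespace SemialgebraicOver

variable {A : Subalgebra ℝ (D → ℝ)} {S S' : Set D}

lemma union (hS : SemialgebraicOver A S) (hS' : SemialgebraicOver A S') :
    SemialgebraicOver A (S ∪ S') := by
  have := (hS.compl.inter hS'.compl).compl
  rwa [Set.compl_inter, compl_compl, compl_compl] at this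

lemma empty : SemialgebraicOver A (∅ : Set D) := by
  have := pos (zero_mem A)
  simpa using this

lemma univ : SemialgebraicOver A (Set.univ : Set D) := by
  simpa using (empty (A := A)).compl

lemma const (p : Prop) : SemialgebraicOver A {_d : D | p} := by
  by_cases hp : p
  · simpa [hp] using univ (A := A)
  · simpa [hp] using empty (A := A)

lemma eq_zero {f : D → ℝ} (hf : f ∈ A) : SemialgebraicOver A {d | f d = 0} := by
  have := (pos hf).compl.inter (pos (neg_mem hf)).compl
  convert this using 1
  ext d
  simp
  constructor
  · intro h; simp [h]
  · rintro ⟨h1, h2⟩; linarith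

lemma biUnion {κ : Type*} {s : Set κ} (hs : s.Finite) {B : κ → Set D}
    (hB : ∀ i ∈ s, SemialgebraicOver A (B i)) : SemialgebraicOver A (⋃ i ∈ s, B i) := by
  induction s, hs using Set.Finite.induction_on with
  | empty => simpa using empty
  | insert _ _ ih =>
    rw [Set.biUnion_insert]
    exact (hB _ (Set.mem_insert _ _)).union (ih fun i hi => hB i (Set.mem_insert_of_mem _ hi))

lemma biInter {κ : Type*} {s : Set κ} (hs : s.Finite) {B : κ → Set D}
    (hB : ∀ i ∈ s, SemialgebraicOver A (B i)) : SemialgebraicOver A (⋂ i ∈ s, B i) := by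
  have := (biUnion hs fun i hi => (hB i hi).compl).compl
  simpa using this

lemma and {p q : D → Prop} (hp : SemialgebraicOver A {d | p d})
    (hq : SemialgebraicOver A {d | q d}) : SemialgebraicOver A {d | p d ∧ q d} := hp.inter hq

lemma or {p q : D → Prop} (hp : SemialgebraicOver A {d | p d})
    (hq : SemialgebraicOver A {d | q d}) : SemialgebraicOver A {d | p d ∨ q d} := hp.union hq

lemma not {p : D → Prop} (hp : SemialgebraicOver A {d | p d}) :
    SemialgebraicOver A {d | ¬ p d} := hp.compl

lemma imp {p q : D → Prop} (hp : SemialgebraicOver A {d | p d})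
    (hq : SemialgebraicOver A {d | q d}) : SemialgebraicOver A {d | p d → q d} := by
  simp only [imp_iff_not_or]
  exact hp.not.or hq

lemma forall_mem {κ : Type*} (s : Finset κ) {p : κ → D → Prop}
    (hp : ∀ i ∈ s, SemialgebraicOver A {d | p i d}) :
    SemialgebraicOver A {d | ∀ i ∈ s, p i d} := by
  have := biInter s.finite_toSet hp
  convert this using 1
  ext d
  simp

/-- Pull-back along a map that pulls the functions of one algebra back to another. -/
lemma preimage {D' : Type*} {A' : Subalgebra ℝ (D' → ℝ)} {φ : D' → D}
    (hφ : ∀ f ∈ A, f ∘ φ ∈ A') (hS : SemialgebraicOver A S) : SemialgebraicOver A' (φ ⁻¹' S) := by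
  induction hS with
  | pos hf => exact pos (hφ _ hf)
  | compl _ ih => exact ih.compl
  | inter _ _ ih ih' => exact ih.inter ih'

end SemialgebraicOver

/-- A solution set of finitely many equations and strict inequalities between functions in `A`. -/
def IsBasicOver (A : Subalgebra ℝ (D → ℝ)) (S : Set D) : Prop :=
  ∃ P Q : Finset (D → ℝ), ↑P ⊆ (A : Set (D → ℝ)) ∧ ↑Q ⊆ (A : Set (D → ℝ)) ∧
    S = {d | (∀ g ∈ P, g d = 0) ∧ ∀ h ∈ Q, 0 < h d}

/-- A finite union of sets that are basic over `A`. -/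
def IsUnionOfBasicOver (A : Subalgebra ℝ (D → ℝ)) (S : Set D) : Prop :=
  ∃ 𝒜 : Set (Set D), 𝒜.Finite ∧ (∀ B ∈ 𝒜, IsBasicOver A B) ∧ S = ⋃₀ 𝒜

section NormalForm

variable {A : Subalgebra ℝ (D → ℝ)} {S S' : Set D}

lemma IsBasicOver.inter (hS : IsBasicOver A S) (hS' : IsBasicOver A S') :
    IsBasicOver A (S ∩ S') := by
  classical
  obtain ⟨P, Q, hP, hQ, rfl⟩ := hS
  obtain ⟨P', Q', hP', hQ', rfl⟩ := hS'
  refine ⟨P ∪ P', Q ∪ Q', by simp [hP, hP'], by simp [hQ, hQ'], ?_⟩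
  ext d
  simp only [Set.mem_inter_iff, Set.mem_ofPred_eq, Finset.mem_union, or_imp, forall_and]
  tauto

lemma IsBasicOver.isUnionOfBasicOver (hS : IsBasicOver A S) : IsUnionOfBasicOver A S :=
  ⟨{S}, Set.finite_singleton S, by simpa using hS, by simp⟩

lemma isBasicOver_pos {f : D → ℝ} (hf : f ∈ A) : IsBasicOver A {d | 0 < f d} :=
  ⟨∅, {f}, by simp, by simpa using hf, by simp⟩

lemma isBasicOver_eq_zero {f : D → ℝ} (hf : f ∈ A) : IsBasicOver A {d | f d = 0} :=
  ⟨{f}, ∅, by simpa using hf, by simp, by simp⟩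

lemma isBasicOver_univ : IsBasicOver A Set.univ := ⟨∅, ∅, by simp, by simp, by simp⟩

lemma IsUnionOfBasicOver.union (hS : IsUnionOfBasicOver A S) (hS' : IsUnionOfBasicOver A S') :
    IsUnionOfBasicOver A (S ∪ S') := by
  obtain ⟨𝒜, h1, h2, rfl⟩ := hS
  obtain ⟨𝒜', h1', h2', rfl⟩ := hS'
  refine ⟨𝒜 ∪ 𝒜', h1.union h1', ?_, (Set.sUnion_union _ _).symm⟩
  rintro B (hB | hB)
  exacts [h2 B hB, h2' B hB]

lemma IsUnionOfBasicOver.inter (hS : IsUnionOfBasicOver A S) (hS' : IsUnionOfBasicOver A S') :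
    IsUnionOfBasicOver A (S ∩ S') := by
  obtain ⟨𝒜, h1, h2, rfl⟩ := hS
  obtain ⟨𝒜', h1', h2', rfl⟩ := hS'
  refine ⟨Set.image2 (· ∩ ·) 𝒜 𝒜', h1.image2 _ h1', ?_, ?_⟩
  · rintro _ ⟨B, hB, B', hB', rfl⟩
    exact (h2 B hB).inter (h2' B' hB')
  · ext d
    simp only [Set.mem_inter_iff, Set.mem_sUnion, Set.mem_image2]
    constructor
    · rintro ⟨⟨B, hB, hd⟩, B', hB', hd'⟩
      exact ⟨_, ⟨B, hB, B', hB', rfl⟩, hd, hd'⟩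
    · rintro ⟨_, ⟨B, hB, B', hB', rfl⟩, hd, hd'⟩
      exact ⟨⟨B, hB, hd⟩, B', hB', hd'⟩

lemma IsUnionOfBasicOver.biUnion {κ : Type*} {s : Set κ} (hs : s.Finite) {B : κ → Set D}
    (hB : ∀ i ∈ s, IsUnionOfBasicOver A (B i)) : IsUnionOfBasicOver A (⋃ i ∈ s, B i) := by
  induction s, hs using Set.Finite.induction_on with
  | empty => exact ⟨∅, by simp, by simp, by simp⟩
  | insert _ _ ih =>
    rw [Set.biUnion_insert]
    exact (hB _ (Set.mem_insert _ _)).union (ih fun i hi => hB i (Set.mem_insert_of_mem _ hi))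

lemma IsUnionOfBasicOver.biInter {κ : Type*} {s : Set κ} (hs : s.Finite) {B : κ → Set D}
    (hB : ∀ i ∈ s, IsUnionOfBasicOver A (B i)) : IsUnionOfBasicOver A (⋂ i ∈ s, B i) := by
  induction s, hs using Set.Finite.induction_on with
  | empty => simpa using isBasicOver_univ.isUnionOfBasicOver
  | insert _ _ ih =>
    rw [Set.biInter_insert]
    exact (hB _ (Set.mem_insert _ _)).inter (ih fun i hi => hB i (Set.mem_insert_of_mem _ hi))

/-- Failure of `g = 0` means `g > 0` or `-g > 0`; failure of `h > 0` means `h = 0` or `-h > 0`. -/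
lemma IsBasicOver.compl (hS : IsBasicOver A S) : IsUnionOfBasicOver A Sᶜ := by
  obtain ⟨P, Q, hP, hQ, rfl⟩ := hS
  have h1 := IsUnionOfBasicOver.biUnion P.finite_toSet
    (B := fun g => {d | 0 < g d} ∪ {d | 0 < (-g) d})
    fun g hg => (isBasicOver_pos (hP hg)).isUnionOfBasicOver.union
      (isBasicOver_pos (neg_mem (hP hg))).isUnionOfBasicOver
  have h2 := IsUnionOfBasicOver.biUnion Q.finite_toSet
    (B := fun g => {d | g d = 0} ∪ {d | 0 < (-g) d})
    fun g hg => (isBasicOver_eq_zero (hQ hg)).isUnionOfBasicOver.union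
      (isBasicOver_pos (neg_mem (hQ hg))).isUnionOfBasicOver
  convert h1.union h2 using 1
  ext d
  simp only [Set.mem_compl_iff, Set.mem_ofPred_eq, not_and_or, not_forall, Set.mem_union,
    Set.mem_iUnion, Finset.mem_coe, Pi.neg_apply, Left.neg_pos_iff, not_lt, exists_prop]
  refine or_congr (exists_congr fun g => and_congr_right fun _ => ?_)
    (exists_congr fun g => and_congr_right fun _ => ?_)
  · rw [← ne_eq, ne_iff_lt_or_gt, or_comm]
  · rw [le_iff_lt_or_eq, or_comm]

lemma IsUnionOfBasicOver.compl (hS : IsUnionOfBasicOver A S) : IsUnionOfBasicOver A Sᶜ := by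
  obtain ⟨𝒜, h1, h2, rfl⟩ := hS
  have := IsUnionOfBasicOver.biInter h1 fun B hB => (h2 B hB).compl
  convert this using 1
  ext d
  simp

/-- Disjunctive normal form; it reduces quantifier elimination to conjunctions of equations and
strict inequalities. -/
lemma SemialgebraicOver.isUnionOfBasicOver (hS : SemialgebraicOver A S) :
    IsUnionOfBasicOver A S := by
  induction hS with
  | pos hf => exact (isBasicOver_pos hf).isUnionOfBasicOver
  | compl _ ih => exact ih.compl
  | inter _ _ ih ih' => exact ih.inter ih'

end NormalForm

/-- A function with finitely many values and semialgebraic fibres. -/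
def IsSimpleOver (A : Subalgebra ℝ (D → ℝ)) (φ : D → T) : Prop :=
  (Set.range φ).Finite ∧ ∀ t, SemialgebraicOver A {d | φ d = t}

namespace IsSimpleOver

variable {A : Subalgebra ℝ (D → ℝ)}

lemma mem {φ : D → T} (hφ : IsSimpleOver A φ) (s : Set T) :
    SemialgebraicOver A {d | φ d ∈ s} := by
  have := SemialgebraicOver.biUnion (hφ.1.inter_of_left s) fun t _ => hφ.2 t
  convert this using 1
  ext d
  simp

lemma const (t : T) : IsSimpleOver A (fun _ : D => t) :=
  ⟨(Set.finite_singleton t).subset (by rintro _ ⟨d, rfl⟩; rfl), fun _ => .const _⟩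

lemma map₂ {φ : D → T} {ψ : D → T'} (hφ : IsSimpleOver A φ) (hψ : IsSimpleOver A ψ)
    (op : T → T' → T'') : IsSimpleOver A (fun d => op (φ d) (ψ d)) := by
  have hfin := hφ.1.prod hψ.1
  refine ⟨(hfin.image fun z => op z.1 z.2).subset ?_, fun t => ?_⟩
  · rintro _ ⟨d, rfl⟩
    exact ⟨(φ d, ψ d), ⟨⟨d, rfl⟩, ⟨d, rfl⟩⟩, rfl⟩
  · have := SemialgebraicOver.biUnion (hfin.inter_of_left {z | op z.1 z.2 = t})
      fun z _ => (hφ.2 z.1).and (hψ.2 z.2)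
    convert this using 1
    ext d
    simp only [Set.mem_ofPred_eq, Set.mem_iUnion, exists_prop, Set.mem_inter_iff, Prod.exists]
    constructor
    · intro h
      exact ⟨φ d, ψ d, ⟨⟨⟨d, rfl⟩, ⟨d, rfl⟩⟩, h⟩, rfl, rfl⟩
    · rintro ⟨a, b, ⟨_, h⟩, rfl, rfl⟩
      exact h

lemma piecewise {φ φ₁ φ₂ : D → T} {S : Set D} (hS : SemialgebraicOver A S)
    (h₁ : IsSimpleOver A φ₁) (h₂ : IsSimpleOver A φ₂) (e₁ : ∀ d ∈ S, φ d = φ₁ d)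
    (e₂ : ∀ d ∉ S, φ d = φ₂ d) : IsSimpleOver A φ := by
  refine ⟨(h₁.1.union h₂.1).subset ?_, fun t => ?_⟩
  · rintro _ ⟨d, rfl⟩
    by_cases hd : d ∈ S
    · exact Or.inl ⟨d, (e₁ d hd).symm⟩
    · exact Or.inr ⟨d, (e₂ d hd).symm⟩
  · convert (hS.inter (h₁.2 t)).union (hS.compl.inter (h₂.2 t)) using 1
    ext d
    by_cases hd : d ∈ S
    · simp [hd, e₁ d hd]
    · simp [hd, e₂ d hd]

lemma sign {f : D → ℝ} (hf : f ∈ A) : IsSimpleOver A (fun d => (SignType.sign (f d) : ℤ)) := by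
  classical
  refine piecewise (φ₁ := fun _ => 1) (φ₂ := fun d => if f d = 0 then 0 else -1) (.pos hf)
    (const 1) (piecewise (φ₁ := fun _ => 0) (φ₂ := fun _ => -1) (.eq_zero hf) (const 0)
      (const (-1)) ?_ ?_) ?_ ?_
  · intro d hd
    exact if_pos hd
  · intro d hd
    exact if_neg hd
  · intro d hd
    simp [sign_pos (show 0 < f d from hd)]
  · intro d hd
    rcases (not_lt.1 (show ¬ 0 < f d from hd)).eq_or_lt with h | h
    · simp [h]
    · simp [h.ne, sign_neg h]

lemma ite {φ₁ φ₂ : D → T} {p : D → Prop} [DecidablePred p] (hp : SemialgebraicOver A {d | p d})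
    (h₁ : IsSimpleOver A φ₁) (h₂ : IsSimpleOver A φ₂) :
    IsSimpleOver A (fun d => if p d then φ₁ d else φ₂ d) :=
  piecewise hp h₁ h₂ (fun _ hd => if_pos hd) (fun _ hd => if_neg hd)

lemma sum {κ : Type*} (s : Finset κ) {φ : κ → D → ℤ} (hφ : ∀ i ∈ s, IsSimpleOver A (φ i)) :
    IsSimpleOver A (fun d => ∑ i ∈ s, φ i d) := by
  classical
  induction s using Finset.induction_on with
  | empty => simpa using const (A := A) (0 : ℤ)
  | insert i s hi ih =>
    simp only [Finset.sum_insert hi]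
    exact (hφ i (Finset.mem_insert_self _ _)).map₂
      (ih fun j hj => hφ j (Finset.mem_insert_of_mem hj)) (· + ·)

end IsSimpleOver

end BooleanClosure

/-! ### Elimination of one real quantifier (Tarski–Seidenberg). -/

section Elimination

open Polynomial

variable {D : Type*} {A : Subalgebra ℝ (D → ℝ)} {B : Type*} [CommRing B] {ev : D → B →+* ℝ}

/-- Degrees vary with the parameter `d`, so recursions run on formal degree bounds: where the top
coefficient vanishes, that term is dropped. -/
lemma map_eq_map_erase {p : B[X]} {n : ℕ} (d : D)
    (h : ev d (p.coeff n) = 0) : p.map (ev d) = (p.erase n).map (ev d) := by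
  ext k
  rw [coeff_map, coeff_map, coeff_erase]
  split_ifs with hk
  · rw [hk, h, map_zero]
  · rfl

lemma degree_erase_lt_of_degree_lt_succ {p : B[X]} {n : ℕ} (h : p.degree < (n + 1 : ℕ)) :
    (p.erase n).degree < n := by
  rw [degree_lt_iff_coeff_zero] at h ⊢
  intro m hm
  rw [coeff_erase]
  split_ifs with hk
  · rfl
  · exact h m (by omega)

lemma natDegree_map_of_coeff_ne_zero {p : B[X]} {n : ℕ} {d : D} (h : p.degree < (n + 1 : ℕ))
    (hn : ev d (p.coeff n) ≠ 0) : (p.map (ev d)).natDegree = n := by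
  apply natDegree_eq_of_le_of_coeff_ne_zero
  · rw [natDegree_le_iff_coeff_eq_zero]
    intro m hm
    rw [coeff_map, (degree_lt_iff_coeff_zero _ _).1 h m hm, map_zero]
  · rwa [coeff_map]

lemma leadingCoeff_map_of_coeff_ne_zero {p : B[X]} {n : ℕ} {d : D} (h : p.degree < (n + 1 : ℕ))
    (hn : ev d (p.coeff n) ≠ 0) :
    (p.map (ev d)).leadingCoeff = ev d (p.coeff n) := by
  rw [leadingCoeff, natDegree_map_of_coeff_ne_zero h hn, coeff_map]

lemma map_ne_zero_of_coeff_ne_zero {p : B[X]} {n : ℕ} {d : D}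
    (hn : ev d (p.coeff n) ≠ 0) : p.map (ev d) ≠ 0 := by
  intro h
  rw [← coeff_map, h] at hn
  simp at hn

lemma eq_zero_of_degree_lt_zero {p : B[X]} (h : p.degree < (0 : ℕ)) : p = 0 := by
  rw [← degree_eq_bot]
  simpa using h

/-- One step of pseudo-division of `h` by `f`. -/
noncomputable def pseudoStep (h f : B[X]) (n m : ℕ) : B[X] :=
  C (f.coeff m ^ 2) * h - C (f.coeff m * h.coeff n) * (X ^ (n - m) * f)

lemma degree_pseudoStep_lt {h f : B[X]} {n m : ℕ} (hmn : m ≤ n) (hh : h.degree < (n + 1 : ℕ))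
    (hf : f.degree < (m + 1 : ℕ)) : (pseudoStep h f n m).degree < n := by
  rw [degree_lt_iff_coeff_zero] at hh hf ⊢
  intro k hk
  rw [pseudoStep, coeff_sub, coeff_C_mul, coeff_C_mul, coeff_X_pow_mul', if_pos (by omega)]
  rcases hk.eq_or_lt with rfl | hk
  · rw [Nat.sub_sub_self hmn]; ring
  · rw [hh k hk, hf (k - (n - m)) (by omega)]; ring

/-- Pseudo-division multiplies `h` by the square of the leading coefficient of `f`, so the factor is
positive and the index is preserved. -/
lemma cauchyIndex_pseudoStep (h f : B[X]) {n m : ℕ} {d : D}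
    (hm : ev d (f.coeff m) ≠ 0) :
    cauchyIndex (h.map (ev d)) (f.map (ev d)) =
      cauchyIndex ((pseudoStep h f n m).map (ev d)) (f.map (ev d)) := by
  refine cauchyIndex_congr (a := ev d (f.coeff m) ^ 2)
    (q := - (C (ev d (f.coeff m) * ev d (h.coeff n)) * X ^ (n - m))) (by positivity) ?_
  simp only [pseudoStep, Polynomial.map_sub, Polynomial.map_mul, Polynomial.map_pow, map_C, map_X,
    map_mul, map_pow]
  ring

/-- Euclid's algorithm with parameters, by induction on the sum of the degree bounds. A vanishing
top coefficient lowers a bound; otherwise one divides, after exchanging `h` and `f` by reciprocity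
if `f` has the larger degree. -/
lemma isSimpleOver_cauchyIndex (hev : ∀ b, (fun d => ev d b) ∈ A) (h f : B[X]) :
    IsSimpleOver A (fun d => cauchyIndex (h.map (ev d)) (f.map (ev d))) := by
  suffices H : ∀ (N n m : ℕ) (h f : B[X]), n + m = N → h.degree < n → f.degree < m →
      IsSimpleOver A (fun d => cauchyIndex (h.map (ev d)) (f.map (ev d))) from
    H _ (h.natDegree + 1) (f.natDegree + 1) h f rfl
      (degree_le_natDegree.trans_lt (by exact_mod_cast Nat.lt_succ_self _))
      (degree_le_natDegree.trans_lt (by exact_mod_cast Nat.lt_succ_self _))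
  intro N
  induction N using Nat.strong_induction_on with
  | _ N ih =>
  rintro n m h f rfl hh hf
  rcases n with _ | n
  · rw [eq_zero_of_degree_lt_zero hh]
    simpa [cauchyIndex] using IsSimpleOver.const (A := A) (0 : ℤ)
  rcases m with _ | m
  · rw [eq_zero_of_degree_lt_zero hf]
    simpa [cauchyIndex] using IsSimpleOver.const (A := A) (0 : ℤ)
  -- The branch where both top coefficients are nonzero, so that `n` and `m` are the true degrees.
  have hstep : IsSimpleOver A fun d => if m ≤ n then
      cauchyIndex ((pseudoStep h f n m).map (ev d)) (f.map (ev d)) else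
      (((SignType.sign (ev d (h.coeff n * f.coeff m)) : ℤ) -
        SignType.sign (ev d ((-1) ^ (n + m) * (h.coeff n * f.coeff m)))) / 2 -
        cauchyIndex ((pseudoStep f h m n).map (ev d)) (h.map (ev d))) := by
    by_cases hmn : m ≤ n
    · simp only [if_pos hmn]
      exact ih (n + (m + 1)) (by omega) n (m + 1) _ f rfl (degree_pseudoStep_lt hmn hh hf) hf
    · simp only [if_neg hmn]
      exact ((IsSimpleOver.sign (hev _)).map₂ (IsSimpleOver.sign (hev _))
        (fun a b => (a - b) / 2)).map₂ (ih (m + (n + 1)) (by omega) m (n + 1) _ h rfl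
          (degree_pseudoStep_lt (not_le.1 hmn).le hf hh) hh) (· - ·)
  classical
  have hall := IsSimpleOver.ite (SemialgebraicOver.eq_zero (hev (h.coeff n)))
    (ih (n + (m + 1)) (by omega) n (m + 1) (h.erase n) f rfl
      (degree_erase_lt_of_degree_lt_succ hh) hf)
    (.ite (.eq_zero (hev (f.coeff m))) (ih (n + 1 + m) (by omega) (n + 1) m h (f.erase m) rfl hh
      (degree_erase_lt_of_degree_lt_succ hf)) hstep)
  convert hall using 2 with d
  split_ifs with h0 f0 hmn
  · rw [map_eq_map_erase d h0]
  · rw [map_eq_map_erase d f0]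
  · exact cauchyIndex_pseudoStep h f f0
  · have e := two_mul_cauchyIndex_add (map_ne_zero_of_coeff_ne_zero h0)
      (map_ne_zero_of_coeff_ne_zero f0)
    rw [leadingCoeff_map_of_coeff_ne_zero hh h0, leadingCoeff_map_of_coeff_ne_zero hf f0,
      natDegree_map_of_coeff_ne_zero hh h0,
      natDegree_map_of_coeff_ne_zero hf f0, cauchyIndex_pseudoStep f h (n := m) h0] at e
    simp only [map_mul, map_pow, map_neg, map_one]
    rw [← e]
    omega

/-- The sum of the signs of `g` at the roots of `f` is a semialgebraic function of parameters. -/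
lemma isSimpleOver_sum_sign_roots (hev : ∀ b, (fun d => ev d b) ∈ A) (f g : B[X]) :
    IsSimpleOver A (fun d => ∑ x ∈ (f.map (ev d)).roots.toFinset,
      (SignType.sign ((g.map (ev d)).eval x) : ℤ)) := by
  have := isSimpleOver_cauchyIndex hev (derivative f * g) f
  convert this using 2 with d
  rw [← cauchyIndex_derivative_mul, Polynomial.map_mul, derivative_map]

lemma isSimpleOver_sign_leadingCoeff (hev : ∀ b, (fun d => ev d b) ∈ A) (p : B[X]) :
    IsSimpleOver A (fun d => SignType.sign (p.map (ev d)).leadingCoeff) := by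
  suffices H : ∀ (n : ℕ) (p : B[X]), p.degree < n →
      IsSimpleOver A (fun d => (SignType.sign (p.map (ev d)).leadingCoeff : ℤ)) by
    have := (H (p.natDegree + 1) p
      (degree_le_natDegree.trans_lt (by exact_mod_cast Nat.lt_succ_self _)))
    have h := this.map₂ this (fun a _ => (SignType.sign a))
    convert h using 2 with d
    generalize SignType.sign (p.map (ev d)).leadingCoeff = s
    cases s <;> rfl
  intro n
  induction n with
  | zero =>
    intro p hp
    rw [eq_zero_of_degree_lt_zero hp]
    simpa using IsSimpleOver.const (A := A) (0 : ℤ)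
  | succ n ih =>
    intro p hp
    classical
    have := IsSimpleOver.ite (SemialgebraicOver.eq_zero (hev (p.coeff n)))
      (ih (p.erase n) (degree_erase_lt_of_degree_lt_succ hp)) (IsSimpleOver.sign (hev (p.coeff n)))
    convert this using 2 with d
    split_ifs with h0
    · rw [map_eq_map_erase d h0]
    · rw [leadingCoeff_map_of_coeff_ne_zero hp h0]

/-- For a sign `σ`, the number `σ ^ 2 + σ` is positive if `σ = 1` and zero otherwise. The sum over
roots of the product of these over `Q` is thus positive iff some root qualifies; expanding the
product over subsets of `Q` gives sums of signs at roots. -/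
lemma semialgebraicOver_exists_root (hev : ∀ b, (fun d => ev d b) ∈ A) (f : B[X])
    (Q : Finset B[X]) :
    SemialgebraicOver A {d | ∃ x ∈ (f.map (ev d)).roots.toFinset,
      ∀ h ∈ Q, 0 < (h.map (ev d)).eval x} := by
  classical
  have hs := IsSimpleOver.sum Q.powerset fun s _ =>
    isSimpleOver_sum_sign_roots hev f ((∏ h ∈ s, h ^ 2) * ∏ h ∈ Q \ s, h)
  have := hs.mem (Set.Ioi 0)
  convert this using 1
  ext d
  simp only [Set.mem_ofPred_eq, Set.mem_Ioi]
  rw [Finset.sum_comm]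
  have e : ∀ x, ∑ s ∈ Q.powerset, (SignType.sign
      ((((∏ h ∈ s, h ^ 2) * ∏ h ∈ Q \ s, h).map (ev d)).eval x) : ℤ) =
      ∏ h ∈ Q, ((SignType.sign ((h.map (ev d)).eval x) : ℤ) ^ 2 +
        (SignType.sign ((h.map (ev d)).eval x) : ℤ)) := by
    intro x
    rw [Finset.prod_add]
    refine Finset.sum_congr rfl fun s _ => ?_
    simp only [Polynomial.map_mul, Polynomial.map_prod, Polynomial.map_pow, eval_mul, eval_prod,
      eval_pow, sign_mul, ← signHom_apply, map_prod, map_pow,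
      SignType.coe_mul]
    simp only [← SignType.castHom_apply (α := ℤ), map_prod, map_pow]
  simp only [e]
  have hpos : ∀ r : ℝ, 0 ≤ (SignType.sign r : ℤ) ^ 2 + SignType.sign r ∧
      (0 < (SignType.sign r : ℤ) ^ 2 + SignType.sign r ↔ 0 < r) := by
    intro r
    rcases lt_trichotomy r 0 with h | h | h
    · simp [sign_neg h, h.le]
    · simp [h]
    · simp [sign_pos h, h]
  constructor
  · rintro ⟨x, hx, h⟩
    exact Finset.sum_pos' (fun y _ => Finset.prod_nonneg fun q _ => (hpos _).1)
      ⟨x, hx, Finset.prod_pos fun q hq => (hpos _).2.2 (h q hq)⟩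
  · intro h
    obtain ⟨x, hx, hx'⟩ := Finset.exists_lt_of_sum_lt (by simpa using h :
      ∑ x ∈ (f.map (ev d)).roots.toFinset, (0 : ℤ) < _)
    refine ⟨x, hx, fun q hq => (hpos _).2.1 (lt_of_le_of_ne (hpos _).1 fun h0 => hx'.ne ?_)⟩
    exact (Finset.prod_eq_zero hq h0.symm).symm

variable {κ : Type*} {Q : Finset κ} {q : κ → ℝ[X]}

lemma prod_eval_eq_zero {x : ℝ} :
    (∏ h ∈ Q, q h).eval x = 0 ↔ ∃ h ∈ Q, (q h).eval x = 0 := by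
  rw [eval_prod, Finset.prod_eq_zero_iff]

/-- Polynomials that are positive at a point of an interval and whose product has no roots there
are positive on the interval. -/
lemma eval_pos_of_prod_ne_zero {s : Set ℝ} (hs : s.OrdConnected)
    (hne : ∀ y ∈ s, (∏ h ∈ Q, q h).eval y ≠ 0) {x y : ℝ} (hx : x ∈ s) (hy : y ∈ s)
    (hpos : ∀ h ∈ Q, 0 < (q h).eval x) : ∀ h ∈ Q, 0 < (q h).eval y := by
  intro h hh
  have := sign_eval_eq_of_forall_ne_zero hs (P := q h)
    (fun z hz h0 => hne z hz (prod_eval_eq_zero.2 ⟨h, hh, h0⟩)) hx hy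
  rw [sign_pos (hpos h hh), eq_comm, sign_eq_one_iff] at this
  exact this

lemma leadingCoeff_pos_of_eventually_pos {p : ℝ[X]} {x : ℝ} (h : ∀ y, x ≤ y → 0 < p.eval y) :
    0 < p.leadingCoeff := by
  obtain ⟨t, h1, h2⟩ := ((eventually_sign_eval_atTop p).and (Filter.eventually_ge_atTop x)).exists
  rwa [sign_pos (h t h2), eq_comm, sign_eq_one_iff] at h1

lemma exists_forall_eval_pos_of_leadingCoeff_pos
    (h : ∀ p ∈ Q, 0 < (q p).leadingCoeff) : ∃ x, ∀ p ∈ Q, 0 < (q p).eval x := by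
  have : ∀ᶠ t in Filter.atTop, ∀ p ∈ Q, SignType.sign ((q p).eval t) =
      SignType.sign (q p).leadingCoeff :=
    (Filter.eventually_all_finset Q).2 fun p _ => eventually_sign_eval_atTop (q p)
  obtain ⟨t, ht⟩ := this.exists
  exact ⟨t, fun p hp => sign_eq_one_iff.1 ((ht p hp).trans (sign_pos (h p hp)))⟩

/-- Finitely many polynomials are simultaneously positive somewhere iff they are so near `+∞`,
near `-∞`, or at a critical point of their product. -/
lemma exists_forall_eval_pos_iff (Q : Finset κ) (q : κ → ℝ[X]) :
    (∃ x, ∀ h ∈ Q, 0 < (q h).eval x) ↔ (∀ h ∈ Q, 0 < (q h).leadingCoeff) ∨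
      (∀ h ∈ Q, 0 < ((q h).comp (-X)).leadingCoeff) ∨
      ∃ x ∈ (derivative (∏ h ∈ Q, q h)).roots.toFinset, ∀ h ∈ Q, 0 < (q h).eval x := by
  constructor
  · rintro ⟨x, hx⟩
    set H := ∏ h ∈ Q, q h with hH
    have hHx : H.eval x ≠ 0 := fun h0 => by
      obtain ⟨h, hh, h0⟩ := prod_eval_eq_zero.1 h0
      exact (hx h hh).ne' h0
    have hH0 : H ≠ 0 := by rintro h; simp [h] at hHx
    -- If the product `H` has no root to the right of `x`, positivity persists to `+∞`; the case of
    -- the left side is symmetric.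
    rcases (H.roots.toFinset.filter (x < ·)).eq_empty_or_nonempty with hr | hr
    · left
      intro h hh
      refine leadingCoeff_pos_of_eventually_pos (x := x) fun y hy =>
        eval_pos_of_prod_ne_zero (Set.ordConnected_Ici (a := x)) ?_ (Set.mem_Ici.2 le_rfl) hy
          hx h hh
      intro z hz h0
      rcases (Set.mem_Ici.1 hz).eq_or_lt with rfl | hz
      · exact hHx h0
      · have : z ∈ H.roots.toFinset.filter (x < ·) := by
          simp only [Finset.mem_filter, Multiset.mem_toFinset, mem_roots hH0]
          exact ⟨h0, hz⟩
        simp [hr] at this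
    rcases (H.roots.toFinset.filter (· < x)).eq_empty_or_nonempty with hl | hl
    · right; left
      intro h hh
      refine leadingCoeff_pos_of_eventually_pos (x := -x) fun y hy => ?_
      simp only [eval_comp, eval_neg, eval_X]
      refine eval_pos_of_prod_ne_zero (Set.ordConnected_Iic (a := x)) ?_ (Set.mem_Iic.2 le_rfl)
        (Set.mem_Iic.2 (by linarith)) hx h hh
      intro z hz h0
      rcases (Set.mem_Iic.1 hz).eq_or_lt with rfl | hz
      · exact hHx h0
      · have : z ∈ H.roots.toFinset.filter (· < x) := by
          simp only [Finset.mem_filter, Multiset.mem_toFinset, mem_roots hH0]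
          exact ⟨h0, hz⟩
        simp [hl] at this
    right; right
    -- Now `x` lies between consecutive roots `a < b` of `H`, and Rolle gives a critical point in
    -- the same root-free interval.
    have hb := Finset.min'_mem _ hr
    have ha := Finset.max'_mem _ hl
    have hbm := fun z hz => Finset.min'_le (H.roots.toFinset.filter (x < ·)) z hz
    have ham := fun z hz => Finset.le_max' (H.roots.toFinset.filter (· < x)) z hz
    set b := Finset.min' _ hr
    set a := Finset.max' _ hl
    simp only [Finset.mem_filter, Multiset.mem_toFinset, mem_roots hH0, IsRoot.def] at ha hb ham hbm
    obtain ⟨y, hy, hy0⟩ := exists_hasDerivAt_eq_zero (f := fun t => H.eval t)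
      (f' := fun t => (derivative H).eval t) (ha.2.trans hb.2) H.continuous.continuousOn
      (ha.1.trans hb.1.symm) (fun t _ => H.hasDerivAt t)
    -- Needed because `roots` of the zero polynomial is empty.
    have hd : derivative H ≠ 0 := by
      intro h0
      have hc := derivative_eq_zero.1 h0
      rw [eq_C_of_natDegree_eq_zero hc] at hHx ha
      simp only [eval_C] at hHx ha
      exact hHx ha.1
    refine ⟨y, by simpa [hd] using hy0, eval_pos_of_prod_ne_zero
      (Set.ordConnected_Ioo (a := a) (b := b)) ?_ (Set.mem_Ioo.2 ⟨ha.2, hb.2⟩) hy hx⟩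
    intro z hz h0
    rcases lt_trichotomy z x with h | rfl | h
    · exact absurd hz.1 (not_lt.2 (ham z ⟨h0, h⟩))
    · exact hHx h0
    · exact absurd hz.2 (not_lt.2 (hbm z ⟨h0, h⟩))
  · rintro (h | h | ⟨x, -, h⟩)
    · exact exists_forall_eval_pos_of_leadingCoeff_pos h
    · obtain ⟨x, hx⟩ := exists_forall_eval_pos_of_leadingCoeff_pos
        (q := fun p => (q p).comp (-X)) h
      refine ⟨-x, fun p hp => ?_⟩
      simpa [eval_comp] using hx p hp
    · exact ⟨x, h⟩

lemma semialgebraicOver_leadingCoeff_pos (hev : ∀ b, (fun d => ev d b) ∈ A) (p : B[X]) :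
    SemialgebraicOver A {d | 0 < (p.map (ev d)).leadingCoeff} := by
  simpa [sign_eq_one_iff] using (isSimpleOver_sign_leadingCoeff hev p).2 1

lemma semialgebraicOver_map_eq_zero (hev : ∀ b, (fun d => ev d b) ∈ A) (p : B[X]) :
    SemialgebraicOver A {d | p.map (ev d) = 0} := by
  simpa [sign_eq_zero_iff] using (isSimpleOver_sign_leadingCoeff hev p).2 0

/-- A sum of squares `F` merges the equations. Where `F` specializes to a nonzero polynomial,
solutions are sought among its roots; where it specializes to zero, the equations are void and
`exists_forall_eval_pos_iff` applies. -/
lemma semialgebraicOver_exists_eval (hev : ∀ b, (fun d => ev d b) ∈ A) (P Q : Finset B[X]) :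
    SemialgebraicOver A {d | ∃ x, (∀ g ∈ P, (g.map (ev d)).eval x = 0) ∧
      ∀ h ∈ Q, 0 < (h.map (ev d)).eval x} := by
  classical
  set F : B[X] := ∑ g ∈ P, g ^ 2 with hF
  have hFeval : ∀ d x, (F.map (ev d)).eval x = 0 ↔ ∀ g ∈ P, (g.map (ev d)).eval x = 0 := by
    intro d x
    have : (F.map (ev d)).eval x = ∑ g ∈ P, (g.map (ev d)).eval x ^ 2 := by
      simp [hF, Polynomial.map_sum, eval_finsetSum]
    rw [this, Finset.sum_eq_zero_iff_of_nonneg fun _ _ => sq_nonneg _]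
    simp
  have h1 := semialgebraicOver_exists_root hev F Q
  have h2 := semialgebraicOver_map_eq_zero hev F
  have h3 := SemialgebraicOver.forall_mem Q fun h _ => semialgebraicOver_leadingCoeff_pos hev h
  have h4 := SemialgebraicOver.forall_mem Q fun h _ =>
    semialgebraicOver_leadingCoeff_pos hev (h.comp (-X))
  have h5 := semialgebraicOver_exists_root hev (derivative (∏ h ∈ Q, h)) Q
  convert h1.or (h2.and (h3.or (h4.or h5))) using 1
  ext d
  simp only [Set.mem_ofPred_eq, ← hFeval]
  by_cases hd : F.map (ev d) = 0
  · have hr := exists_forall_eval_pos_iff Q (Polynomial.map (ev d))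
    have hX : ∀ h : B[X], (h.map (ev d)).comp (-X) = (h.comp (-X)).map (ev d) := by
      intro h; simp [Polynomial.map_comp]
    have hD : derivative (∏ h ∈ Q, h.map (ev d)) = (derivative (∏ h ∈ Q, h)).map (ev d) := by
      rw [← derivative_map, Polynomial.map_prod]
    rw [hD] at hr
    simp only [hX] at hr
    simpa [hd] using hr
  · simp [hd]

/-- **Tarski–Seidenberg**: projections along a real variable in which the functions of the algebra
are polynomial preserve semialgebraicity. -/
theorem SemialgebraicOver.exists_real {A' : Subalgebra ℝ (D × ℝ → ℝ)}
    (hev : ∀ b, (fun d => ev d b) ∈ A)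
    (hA' : ∀ f ∈ A', ∃ p : B[X], ∀ d t, f (d, t) = (p.map (ev d)).eval t) {S : Set (D × ℝ)}
    (hS : SemialgebraicOver A' S) : SemialgebraicOver A {d | ∃ t, (d, t) ∈ S} := by
  classical
  obtain ⟨𝒜, hfin, hbasic, rfl⟩ := hS.isUnionOfBasicOver
  have key : ∀ S ∈ 𝒜, SemialgebraicOver A {d | ∃ t, (d, t) ∈ S} := by
    intro S hS
    obtain ⟨P, Q, hP, hQ, rfl⟩ := hbasic S hS
    choose! p hp using hA'
    have := semialgebraicOver_exists_eval hev (P.image p) (Q.image p)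
    convert this using 1
    ext d
    simp only [Set.mem_ofPred_eq, Finset.forall_mem_image]
    refine exists_congr fun t => and_congr ?_ ?_
    · exact forall₂_congr fun g hg => by rw [hp g (hP hg)]
    · exact forall₂_congr fun g hg => by rw [hp g (hQ hg)]
  have := SemialgebraicOver.biUnion hfin key
  convert this using 1
  ext d
  simp only [Set.mem_ofPred_eq, Set.mem_sUnion, Set.mem_iUnion, exists_prop]
  constructor
  · rintro ⟨t, S, hS, ht⟩
    exact ⟨S, hS, t, ht⟩
  · rintro ⟨S, hS, t, ht⟩
    exact ⟨t, S, hS, ht⟩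

end Elimination

/-! ### Coordinate-free polynomial maps and quantifiers over vector spaces. -/

section PolynomialFunctions

variable {D E E' : Type*} [AddCommGroup D] [Module ℝ D] [AddCommGroup E] [Module ℝ E]
  [AddCommGroup E'] [Module ℝ E']

variable (D) in
/-- The algebra of polynomial functions on a real vector space. -/
def polyFun : Subalgebra ℝ (D → ℝ) :=
  Algebra.adjoin ℝ (Set.range fun l : D →ₗ[ℝ] ℝ => (l : D → ℝ))

lemma linear_mem_polyFun (l : D →ₗ[ℝ] ℝ) : (fun d => l d) ∈ polyFun D :=
  Algebra.subset_adjoin ⟨l, rfl⟩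

lemma const_mem_polyFun (r : ℝ) : (fun _ => r) ∈ polyFun D :=
  (polyFun D).algebraMap_mem r

/-- A map between vector spaces is polynomial if its coordinates are polynomial functions. -/
def IsPolyMap (φ : D → E) : Prop := ∀ l : E →ₗ[ℝ] ℝ, (fun d => l (φ d)) ∈ polyFun D

lemma IsPolyMap.comp_mem {φ : D → E} (hφ : IsPolyMap φ) {f : E → ℝ} (hf : f ∈ polyFun E) :
    f ∘ φ ∈ polyFun D := by
  induction hf using Algebra.adjoin_induction with
  | mem f hf => obtain ⟨l, rfl⟩ := hf; exact hφ l
  | algebraMap r => exact const_mem_polyFun r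
  | add f g _ _ hf hg => exact add_mem hf hg
  | mul f g _ _ hf hg => exact mul_mem hf hg

lemma isPolyMap_linear (L : D →ₗ[ℝ] E) : IsPolyMap (fun d => L d) :=
  fun l => linear_mem_polyFun (l.comp L)

lemma isPolyMap_id : IsPolyMap (fun d : D => d) := isPolyMap_linear LinearMap.id

lemma isPolyMap_const (e : E) : IsPolyMap (fun _ : D => e) := fun l => const_mem_polyFun (l e)

lemma IsPolyMap.mem {f : D → ℝ} (hf : IsPolyMap f) : f ∈ polyFun D := hf LinearMap.id

lemma isPolyMap_of_mem {f : D → ℝ} (hf : f ∈ polyFun D) : IsPolyMap f := by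
  intro l
  have : (fun d => l (f d)) = (fun _ => l 1) * f := by
    ext d
    have := l.map_smul (f d) 1
    simpa [mul_comm] using this
  rw [this]
  exact mul_mem (const_mem_polyFun _) hf

lemma IsPolyMap.comp {ψ : E → E'} {φ : D → E} (hψ : IsPolyMap ψ) (hφ : IsPolyMap φ) :
    IsPolyMap (fun d => ψ (φ d)) := fun l => hφ.comp_mem (hψ l)

lemma IsPolyMap.fst {φ : D → E × E'} (hφ : IsPolyMap φ) : IsPolyMap (fun d => (φ d).1) :=
  (isPolyMap_linear (LinearMap.fst ℝ E E')).comp hφ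

lemma IsPolyMap.snd {φ : D → E × E'} (hφ : IsPolyMap φ) : IsPolyMap (fun d => (φ d).2) :=
  (isPolyMap_linear (LinearMap.snd ℝ E E')).comp hφ

lemma IsPolyMap.add {φ ψ : D → E} (hφ : IsPolyMap φ) (hψ : IsPolyMap ψ) :
    IsPolyMap (fun d => φ d + ψ d) := by
  intro l
  simp only [map_add]
  exact add_mem (hφ l) (hψ l)

lemma IsPolyMap.sub {φ ψ : D → E} (hφ : IsPolyMap φ) (hψ : IsPolyMap ψ) :
    IsPolyMap (fun d => φ d - ψ d) := by
  intro l
  simp only [map_sub]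
  exact sub_mem (hφ l) (hψ l)

lemma IsPolyMap.smul {f : D → ℝ} {φ : D → E} (hf : IsPolyMap f) (hφ : IsPolyMap φ) :
    IsPolyMap (fun d => f d • φ d) := by
  intro l
  simp only [map_smul, smul_eq_mul]
  exact mul_mem hf.mem (hφ l)

lemma IsPolyMap.prodMk {φ : D → E} {ψ : D → E'} (hφ : IsPolyMap φ) (hψ : IsPolyMap ψ) :
    IsPolyMap (fun d => (φ d, ψ d)) := by
  intro l
  have : ∀ d, l (φ d, ψ d) = l.comp (LinearMap.inl ℝ E E') (φ d) +
      l.comp (LinearMap.inr ℝ E E') (ψ d) := by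
    intro d
    simp [← map_add]
  simp only [this]
  exact add_mem (hφ _) (hψ _)

lemma isPolyMap_pi {ι : Type*} [Finite ι] {φ : D → ι → ℝ}
    (hφ : ∀ i, IsPolyMap (fun d => φ d i)) : IsPolyMap φ := by
  classical
  have := Fintype.ofFinite ι
  intro l
  have : (fun d => l (φ d)) = ∑ i, (fun d => φ d i) * (fun _ => l (Pi.single i 1)) := by
    ext d
    conv_lhs => rw [pi_eq_sum_univ' (φ d)]
    simp only [map_sum, map_smul, smul_eq_mul, Finset.sum_apply, Pi.mul_apply]
  rw [this]
  exact sum_mem fun i _ => mul_mem (hφ i).mem (const_mem_polyFun _)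

lemma IsPolyMap.inner {E : Type*} [NormedAddCommGroup E] [InnerProductSpace ℝ E]
    [FiniteDimensional ℝ E] {φ ψ : D → E} (hφ : IsPolyMap φ) (hψ : IsPolyMap ψ) :
    IsPolyMap (fun d => (inner ℝ (φ d) (ψ d) : ℝ)) := by
  apply isPolyMap_of_mem
  let b := stdOrthonormalBasis ℝ E
  have : (fun d => (Inner.inner ℝ (φ d) (ψ d) : ℝ)) =
      ∑ i, (fun d => innerₛₗ ℝ (b i) (φ d)) * (fun d => innerₛₗ ℝ (b i) (ψ d)) := by
    ext d
    rw [← b.sum_inner_mul_inner]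
    simp [real_inner_comm]
  rw [this]
  exact sum_mem fun i _ => mul_mem (hφ _) (hψ _)

/-- Semialgebraic subsets of a real vector space. -/
abbrev Semialg (S : Set D) : Prop := SemialgebraicOver (polyFun D) S

lemma Semialg.preimage {S : Set E} (hS : Semialg S) {φ : D → E} (hφ : IsPolyMap φ) :
    Semialg (φ ⁻¹' S) := SemialgebraicOver.preimage (fun _ hf => hφ.comp_mem hf) hS

lemma IsPolyMap.semialg_lt {f g : D → ℝ} (hf : IsPolyMap f) (hg : IsPolyMap g) :
    Semialg {d | f d < g d} := by
  have := SemialgebraicOver.pos (hg.sub hf).mem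
  simpa using this

lemma IsPolyMap.semialg_eq {f g : D → ℝ} (hf : IsPolyMap f) (hg : IsPolyMap g) :
    Semialg {d | f d = g d} := by
  have := SemialgebraicOver.eq_zero (hf.sub hg).mem
  simpa [sub_eq_zero] using this

-- Separating the last variable puts polynomial functions in the form required by
-- `SemialgebraicOver.exists_real`.
open Polynomial in
lemma exists_polynomial_of_mem_polyFun_prod {f : D × ℝ → ℝ} (hf : f ∈ polyFun (D × ℝ)) :
    ∃ p : (polyFun D)[X], ∀ d t, f (d, t) = (p.map ((Pi.evalRingHom (fun _ : D => ℝ) d).comp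
      (polyFun D).val.toRingHom)).eval t := by
  induction hf using Algebra.adjoin_induction with
  | mem f hf =>
    obtain ⟨l, rfl⟩ := hf
    refine ⟨C ⟨_, linear_mem_polyFun (l.comp (LinearMap.inl ℝ D ℝ))⟩ +
      C ⟨_, const_mem_polyFun (l (0, 1))⟩ * X, fun d t => ?_⟩
    have : l (d, t) = l (d, 0) + t * l (0, 1) := by
      rw [← smul_eq_mul, ← map_smul, ← map_add]
      simp
    refine this.trans ?_
    simp only [Polynomial.map_add, Polynomial.map_mul, map_C, map_X, eval_add, eval_mul, eval_C,
      eval_X]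
    rw [mul_comm t]
    rfl
  | algebraMap r =>
    exact ⟨C ⟨_, const_mem_polyFun r⟩, fun d t => by simp⟩
  | add f g _ _ hf hg =>
    obtain ⟨p, hp⟩ := hf
    obtain ⟨q, hq⟩ := hg
    exact ⟨p + q, fun d t => by simp [hp, hq]⟩
  | mul f g _ _ hf hg =>
    obtain ⟨p, hp⟩ := hf
    obtain ⟨q, hq⟩ := hg
    exact ⟨p * q, fun d t => by simp [hp, hq]⟩

lemma Semialg.exists_real {S : Set (D × ℝ)} (hS : Semialg S) : Semialg {d | ∃ t, (d, t) ∈ S} :=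
  SemialgebraicOver.exists_real (ev := fun d => (Pi.evalRingHom (fun _ : D => ℝ) d).comp
      (polyFun D).val.toRingHom) (fun b => b.2)
    (fun _ hf => exists_polynomial_of_mem_polyFun_prod hf) hS

lemma Semialg.exists_fin (n : ℕ) : ∀ {S : Set (D × (Fin n → ℝ))}, Semialg S →
    Semialg {d | ∃ v, (d, v) ∈ S} := by
  induction n with
  | zero =>
    intro S hS
    convert hS.preimage ((isPolyMap_id (D := D)).prodMk (isPolyMap_const 0)) using 1
    ext d
    exact ⟨fun ⟨v, hv⟩ => Subsingleton.elim v 0 ▸ hv, fun h => ⟨0, h⟩⟩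
  | succ n ih =>
    intro S hS
    have hφ : IsPolyMap (fun z : (D × (Fin n → ℝ)) × ℝ =>
        (z.1.1, (Fin.cons z.2 z.1.2 : Fin (n + 1) → ℝ))) := by
      refine isPolyMap_id.fst.fst.prodMk (isPolyMap_pi fun i => ?_)
      refine Fin.cases ?_ (fun i => ?_) i
      · simpa using isPolyMap_id.snd
      · simpa using (isPolyMap_linear (LinearMap.proj (R := ℝ) (φ := fun _ => ℝ) i)).comp
          (isPolyMap_id (D := (D × (Fin n → ℝ)) × ℝ)).fst.snd
    convert ih (hS.preimage hφ).exists_real using 1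
    ext d
    simp [Fin.exists_fin_succ_pi]
    rw [exists_comm]

lemma Semialg.exists [FiniteDimensional ℝ E] {p : D → E → Prop}
    (hp : Semialg {z : D × E | p z.1 z.2}) : Semialg {d | ∃ e, p d e} := by
  let b := (Module.finBasis ℝ E).equivFun
  have hφ : IsPolyMap (fun z : D × (Fin (Module.finrank ℝ E) → ℝ) => (z.1, b.symm z.2)) :=
    isPolyMap_id.fst.prodMk ((isPolyMap_linear b.symm.toLinearMap).comp isPolyMap_id.snd)
  convert Semialg.exists_fin _ (hp.preimage hφ) using 1
  ext d
  exact (b.symm.surjective.exists (p := fun e => p d e))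

lemma Semialg.forall [FiniteDimensional ℝ E] {p : D → E → Prop}
    (hp : Semialg {z : D × E | p z.1 z.2}) : Semialg {d | ∀ e, p d e} := by
  have := (Semialg.exists (p := fun d e => ¬ p d e) hp.not).not
  simpa using this

end PolynomialFunctions

/-! ### Comparison with semialgebraic sets given by `MvPolynomial`. -/

section Coordinates

variable {ι : Type*}

lemma eval_mem_polyFun (g : MvPolynomial ι ℝ) :
    (fun c : ι → ℝ => MvPolynomial.eval c g) ∈ polyFun (ι → ℝ) := by
  induction g using MvPolynomial.induction_on with
  | C r => simpa using const_mem_polyFun r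
  | add p q hp hq => simp only [map_add]; exact add_mem hp hq
  | mul_X p i hp =>
    simp only [map_mul, MvPolynomial.eval_X]
    exact mul_mem hp (linear_mem_polyFun (LinearMap.proj (R := ℝ) (φ := fun _ => ℝ) i))

lemma exists_eval_eq_of_mem_polyFun [Finite ι] {f : (ι → ℝ) → ℝ} (hf : f ∈ polyFun (ι → ℝ)) :
    ∃ g : MvPolynomial ι ℝ, ∀ c, f c = MvPolynomial.eval c g := by
  classical
  have := Fintype.ofFinite ι
  induction hf using Algebra.adjoin_induction with
  | mem f hf =>
    obtain ⟨l, rfl⟩ := hf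
    refine ⟨∑ i, MvPolynomial.C (l (Pi.single i 1)) * MvPolynomial.X i, fun c => ?_⟩
    simp only [map_sum, map_mul, MvPolynomial.eval_C, MvPolynomial.eval_X]
    conv_lhs => rw [pi_eq_sum_univ' c]
    simp only [map_sum, map_smul, smul_eq_mul]
    refine Finset.sum_congr rfl fun i _ => ?_
    rw [mul_comm]
  | algebraMap r => exact ⟨MvPolynomial.C r, fun c => by simp⟩
  | add f g _ _ hf hg =>
    obtain ⟨p, hp⟩ := hf
    obtain ⟨q, hq⟩ := hg
    exact ⟨p + q, fun c => by simp [hp, hq]⟩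
  | mul f g _ _ hf hg =>
    obtain ⟨p, hp⟩ := hf
    obtain ⟨q, hq⟩ := hg
    exact ⟨p * q, fun c => by simp [hp, hq]⟩

lemma IsSemialgebraic.semialg {S : Set (ι → ℝ)} (hS : IsSemialgebraic S) : Semialg S := by
  obtain ⟨𝒜, hfin, hbasic, rfl⟩ := hS
  rw [Set.sUnion_eq_biUnion]
  refine SemialgebraicOver.biUnion hfin fun B hB => ?_
  obtain ⟨P, Q, rfl⟩ := hbasic B hB
  exact (SemialgebraicOver.forall_mem P fun g _ => .eq_zero (eval_mem_polyFun g)).and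
    (SemialgebraicOver.forall_mem Q fun g _ => .pos (eval_mem_polyFun g))

lemma Semialg.isSemialgebraic [Finite ι] {S : Set (ι → ℝ)} (hS : Semialg S) :
    IsSemialgebraic S := by
  classical
  obtain ⟨𝒜, hfin, hbasic, rfl⟩ := hS.isUnionOfBasicOver
  refine ⟨𝒜, hfin, fun B hB => ?_, rfl⟩
  obtain ⟨P, Q, hP, hQ, rfl⟩ := hbasic B hB
  choose! q hq using fun (f : (ι → ℝ) → ℝ) (hf : f ∈ polyFun (ι → ℝ)) =>
    exists_eval_eq_of_mem_polyFun hf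
  refine ⟨P.image q, Q.image q, ?_⟩
  ext c
  simp only [Set.mem_ofPred_eq, Finset.forall_mem_image]
  refine and_congr ?_ ?_
  · exact forall₂_congr fun g hg => by rw [hq g (hP hg)]
  · exact forall₂_congr fun g hg => by rw [hq g (hQ hg)]

variable {n : ℕ}

lemma semialg_of_coords₂ {S : Set (EuclideanSpace ℝ (Fin n) × EuclideanSpace ℝ (Fin n))}
    (hS : IsSemialgebraic (coords₂ S)) : Semialg S := by
  have hφ : IsPolyMap (fun z : EuclideanSpace ℝ (Fin n) × EuclideanSpace ℝ (Fin n) =>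
      (Sum.elim z.1 z.2 : Fin n ⊕ Fin n → ℝ)) := by
    refine isPolyMap_pi fun i => ?_
    rcases i with i | i
    · exact (isPolyMap_linear (EuclideanSpace.projₗ (𝕜 := ℝ) i)).comp isPolyMap_id.fst
    · exact (isPolyMap_linear (EuclideanSpace.projₗ (𝕜 := ℝ) i)).comp isPolyMap_id.snd
  exact hS.semialg.preimage hφ

lemma Semialg.coords {S : Set (EuclideanSpace ℝ (Fin n))} (hS : Semialg S) :
    IsSemialgebraic (coords S) :=
  (hS.preimage
    (isPolyMap_linear (WithLp.linearEquiv 2 ℝ (Fin n → ℝ)).symm.toLinearMap)).isSemialgebraic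

end Coordinates

/-! ### Submanifolds as regular level sets, and their tangent cones. -/

section LevelSets

open Topology

variable {F W : Type*} [NormedAddCommGroup F] [NormedSpace ℝ F] [FiniteDimensional ℝ F]
  [NormedAddCommGroup W] [NormedSpace ℝ W] [FiniteDimensional ℝ W]

/-- A submanifold is locally the zero set of a submersion. -/
lemma IsSmoothSubmanifold.exists_submersion {M : Set F} (hM : IsSmoothSubmanifold M) {x : F}
    (hx : x ∈ M) : ∃ (L : Submodule ℝ F) (U : Set F) (f : F → L), IsOpen U ∧ x ∈ U ∧
      ContDiffOn ℝ ∞ f U ∧ (∀ y ∈ U, y ∈ M ↔ f y = 0) ∧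
      ∀ y ∈ U, Function.Surjective (fderiv ℝ f y) := by
  obtain ⟨φ, L, hxφ, h1, h2, h3⟩ := hM x hx
  -- Projecting the chart to a complement of `L` along `L` turns membership in `L` into an equation.
  obtain ⟨L', hL⟩ := Submodule.exists_isCompl L
  let π : F →L[ℝ] L' := LinearMap.toContinuousLinearMap (L'.projectionOnto L hL.symm)
  have hπ0 : ∀ v, π v = 0 ↔ v ∈ L := fun v =>
    Submodule.projectionOnto_apply_eq_zero_iff hL.symm
  have hπs : Function.Surjective π := fun w =>
    ⟨w, Submodule.projectionOnto_apply_left hL.symm w⟩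
  refine ⟨L', φ.source, fun y => π (φ y), φ.open_source, hxφ, π.contDiff.comp_contDiffOn h1,
    fun y hy => by rw [h3 y hy, hπ0], fun y hy => ?_⟩
  have hd1 : DifferentiableAt ℝ φ y :=
    (h1.contDiffAt (φ.open_source.mem_nhds hy)).differentiableAt (by simp)
  have hd2 : DifferentiableAt ℝ φ.symm (φ y) :=
    (h2.contDiffAt (φ.open_target.mem_nhds (φ.map_source hy))).differentiableAt (by simp)
  have hd1' : HasFDerivAt φ (fderiv ℝ φ y) (φ.symm (φ y)) := by
    rw [φ.left_inv hy]; exact hd1.hasFDerivAt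
  have hid : HasFDerivAt (φ ∘ φ.symm) (ContinuousLinearMap.id ℝ F) (φ y) := by
    refine (hasFDerivAt_id _).congr_of_eventuallyEq ?_
    filter_upwards [φ.open_target.mem_nhds (φ.map_source hy)] with z hz
    exact φ.right_inv hz
  have hcomp := (hd1'.comp (φ y) hd2.hasFDerivAt).unique hid
  have hder : fderiv ℝ (fun y => π (φ y)) y = π.comp (fderiv ℝ φ y) :=
    (π.hasFDerivAt.comp y hd1.hasFDerivAt).fderiv
  rw [hder]
  intro w
  obtain ⟨v, rfl⟩ := hπs w
  exact ⟨fderiv ℝ φ.symm (φ y) v, congrArg π (DFunLike.congr_fun hcomp v)⟩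

/-- The tangent cone of a regular level set is the kernel of the differential. -/
lemma tangentConeAt_eq_ker {M : Set F} {f : F → W} {x : F} (hf : ContDiffAt ℝ ∞ f x)
    (hs : Function.Surjective (fderiv ℝ f x)) (hx : f x = 0)
    (hM : ∀ᶠ y in 𝓝 x, y ∈ M ↔ f y = 0) :
    tangentConeAt ℝ M x = {v | fderiv ℝ f x v = 0} := by
  have hstrict := hf.hasStrictFDerivAt (by simp)
  apply Set.Subset.antisymm
  -- Near `x` the map `f` is zero on `M`, so its differential sends the cone into the cone of a
  -- point.
  · intro v hv
    have h1 : v ∈ tangentConeAt ℝ (M ∩ {y | y ∈ M ↔ f y = 0}) x := by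
      rwa [tangentConeAt_inter_nhds hM]
    have h2 := (hstrict.hasFDerivAt.hasFDerivWithinAt
      (s := M ∩ {y | y ∈ M ↔ f y = 0})).mapsTo_tangent_cone h1
    have h3 : f '' (M ∩ {y | y ∈ M ↔ f y = 0}) ⊆ {0} := by
      rintro _ ⟨y, ⟨hy, hy'⟩, rfl⟩
      exact hy'.1 hy
    have h4 := tangentConeAt_subset_zero (𝕜 := ℝ) (s := ({0} : Set W)) (x := f x)
      (by rw [accPt_iff_frequently_nhdsNE, Filter.not_frequently, hx]
          filter_upwards [self_mem_nhdsWithin] with y hy using hy)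
    exact h4 (tangentConeAt_mono h3 h2)
  · intro v hv
    -- The implicit function maps a neighbourhood of `0` in the kernel into `M`, with the inclusion
    -- as its differential.
    have hr : (fderiv ℝ f x).range = ⊤ := LinearMap.range_eq_top.2 hs
    have hg := (hstrict.to_implicitFunction hr).hasFDerivAt
    set g := hstrict.implicitFunction f (fderiv ℝ f x) hr (f x) with hgdef
    have hg0 : g 0 = x := hstrict.implicitFunction_apply_image hr
    have ht : Filter.Tendsto (fun k : (fderiv ℝ f x).ker => (f x, k)) (𝓝 0) (𝓝 (f x, 0)) :=
      (Continuous.prodMk_right (f x)).tendsto 0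
    have hgf : ∀ᶠ k in 𝓝 (0 : (fderiv ℝ f x).ker), f (g k) = f x :=
      ht.eventually (hstrict.map_implicitFunction_eq hr)
    have hgM : ∀ᶠ k in 𝓝 (0 : (fderiv ℝ f x).ker), g k ∈ M := by
      have hc : Filter.Tendsto g (𝓝 0) (𝓝 x) := by
        have := hg.continuousAt.tendsto
        rwa [hg0] at this
      filter_upwards [hgf, hc.eventually hM] with k h1 h2
      rw [h2, h1, hx]
    have h1 : (⟨v, hv⟩ : (fderiv ℝ f x).ker) ∈ tangentConeAt ℝ {k | g k ∈ M} 0 := by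
      rw [tangentConeAt_of_mem_nhds hgM]
      trivial
    have h2 := (hg.hasFDerivWithinAt (s := {k | g k ∈ M})).mapsTo_tangent_cone h1
    rw [hg0] at h2
    refine tangentConeAt_mono ?_ h2
    rintro _ ⟨k, hk, rfl⟩
    exact hk

omit [FiniteDimensional ℝ F] [FiniteDimensional ℝ W] in
lemma mem_tangentSpace_of_tangentConeAt_eq {M : Set F} {x : F} {T : F →L[ℝ] W}
    (h : tangentConeAt ℝ M x = {v | T v = 0}) {v : F} : v ∈ tangentSpace M x ↔ T v = 0 := by
  have : {v | T v = 0} = ((LinearMap.ker (T : F →ₗ[ℝ] W) : Submodule ℝ F) : Set F) := by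
    ext v; simp
  rw [tangentSpace, h, this, Submodule.span_eq]
  simp

/-- A set that is locally a regular level set is a submanifold. -/
lemma exists_chart_of_submersion {M : Set F} {f : F → W} {U : Set F} {x : F} (hU : IsOpen U)
    (hx : x ∈ U) (hf : ContDiffOn ℝ ∞ f U) (hM : ∀ y ∈ U, y ∈ M ↔ f y = 0)
    (hs : Function.Surjective (fderiv ℝ f x)) :
    ∃ (φ : OpenPartialHomeomorph F F) (L : Submodule ℝ F),
      x ∈ φ.source ∧ ContDiffOn ℝ ∞ φ φ.source ∧ ContDiffOn ℝ ∞ φ.symm φ.target ∧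
      ∀ y ∈ φ.source, y ∈ M ↔ φ y ∈ L := by
  obtain ⟨s, hsr⟩ := (fderiv ℝ f x).exists_rightInverse_of_surjective (LinearMap.range_eq_top.2 hs)
  have hsr' : ∀ w, fderiv ℝ f x (s w) = w := fun w => DFunLike.congr_fun hsr w
  set f' := fderiv ℝ f x with hf'
  -- With `s` a right inverse of `f'`, the differential of `Φ` at `x` is the identity and `f' ∘ Φ =
  -- f`, so `Φ` straightens `M` to `ker f'`.
  let Φ : F → F := fun y => y - s (f' y) + s (f y)
  have hΦ : ContDiffOn ℝ ∞ Φ U :=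
    (contDiffOn_id.sub ((s.comp f').contDiff.contDiffOn)).add (s.contDiff.comp_contDiffOn hf)
  have hΦx : ContDiffAt ℝ ∞ Φ x := hΦ.contDiffAt (hU.mem_nhds hx)
  have hfx : HasFDerivAt f f' x :=
    ((hf.contDiffAt (hU.mem_nhds hx)).differentiableAt (by simp)).hasFDerivAt
  have hder : HasFDerivAt Φ ((ContinuousLinearEquiv.refl ℝ F : F ≃L[ℝ] F) : F →L[ℝ] F) x := by
    have := ((hasFDerivAt_id x).sub (s.comp f').hasFDerivAt).add (s.hasFDerivAt.comp x hfx)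
    refine this.congr_fderiv ?_
    ext v
    simp
  let ψ := hΦx.toOpenPartialHomeomorph Φ hder (by simp)
  -- Restricting to points where the differential is invertible makes the inverse smooth on the
  -- whole target.
  have hopen : IsOpen (U ∩ fderiv ℝ Φ ⁻¹' Set.range ((↑) : (F ≃L[ℝ] F) → (F →L[ℝ] F))) :=
    (hΦ.continuousOn_fderiv_of_isOpen hU (by simp)).isOpen_inter_preimage hU
      ContinuousLinearEquiv.isOpen
  have hxs : x ∈ ψ.source := hΦx.mem_toOpenPartialHomeomorph_source hder (by simp)
  refine ⟨ψ.restrOpen _ hopen, LinearMap.ker (f' : F →ₗ[ℝ] W), ⟨hxs, hx, ?_⟩, ?_, ?_, ?_⟩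
  · exact ⟨_, hder.fderiv.symm⟩
  · exact hΦ.mono fun y hy => hy.2.1
  · intro z hz
    have hz' := (ψ.restrOpen _ hopen).map_target hz
    obtain ⟨e, he⟩ := hz'.2.2
    refine ((ψ.restrOpen _ hopen).contDiffAt_symm (f₀' := e) hz ?_ ?_).contDiffWithinAt
    · have : DifferentiableAt ℝ Φ ((ψ.restrOpen _ hopen).symm z) :=
        (hΦ.contDiffAt (hU.mem_nhds hz'.2.1)).differentiableAt (by simp)
      have h := this.hasFDerivAt
      rw [← he] at h
      exact h
    · exact hΦ.contDiffAt (hU.mem_nhds hz'.2.1)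
  · intro y hy
    have : f' (Φ y) = f y := by simp [Φ, hsr']
    rw [hM y hy.2.1, ← this]
    rfl

/-- A submanifold is locally closed. -/
lemma IsSmoothSubmanifold.isLocallyClosed {M : Set F} (hM : IsSmoothSubmanifold M) :
    IsLocallyClosed M := by
  refine ((isLocallyClosed_tfae M).out 0 3).2 fun x hx => ?_
  obtain ⟨φ, L, hxφ, h1, -, h3⟩ := hM x hx
  refine ⟨φ.source, hxφ, φ.open_source, ?_⟩
  rintro y ⟨hy, hyM⟩
  rw [h3 y hy]
  by_contra hyL
  have hopen : IsOpen (φ.source ∩ φ ⁻¹' (L : Set F)ᶜ) :=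
    φ.continuousOn.isOpen_inter_preimage φ.open_source L.closed_of_finiteDimensional.isOpen_compl
  obtain ⟨z, ⟨hz, hzL⟩, hzM⟩ := mem_closure_iff.1 hyM _ hopen ⟨hy, hyL⟩
  exact hzL ((h3 z hz).1 hzM)

end LevelSets

/-! ### Local frames for a submersive equivalence relation. -/

section Slices

open Topology

lemma eqvClass_eq {X : Type*} {R : Setoid X} {x y : X} (h : R x y) :
    eqvClass R x = eqvClass R y := by
  ext z
  exact ⟨fun hz => R.trans (R.symm h) hz, fun hz => R.trans h hz⟩

variable {E : Type*} [NormedAddCommGroup E] [InnerProductSpace ℝ E] [FiniteDimensional ℝ E]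

/-- A local description of an equivalence relation near the diagonal: the relation is the zero set
of `F`, the tangent space of the class of `x` at `x` is the kernel of the partial differential
`A x`, and this kernel is parametrized by `B x`. -/
structure LocalFrame (R : Setoid E) (W K : Type*) [NormedAddCommGroup W] [NormedSpace ℝ W]
    [NormedAddCommGroup K] [NormedSpace ℝ K] where
  /-- the domain in `E` -/
  U : Set E
  /-- the domain in `E × E` -/
  Ω : Set (E × E)
  /-- the local equation of the relation -/
  F : E × E → W
  /-- the differential of the equation along the classes -/
  A : E → E →L[ℝ] W
  /-- the frame of the tangent spaces of the classes -/
  B : E → K →L[ℝ] E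
  isOpen_U : IsOpen U
  isOpen_Ω : IsOpen Ω
  diag_mem : ∀ x ∈ U, (x, x) ∈ Ω
  contDiffOn_F : ContDiffOn ℝ ∞ F Ω
  mem_graph_iff : ∀ z ∈ Ω, z ∈ graph R ↔ F z = 0
  A_apply : ∀ x v, A x v = fderiv ℝ F (x, x) (0, v)
  contDiffOn_A : ContDiffOn ℝ ∞ A U
  surjective_A : ∀ x ∈ U, Function.Surjective (A x)
  contDiffOn_B : ContDiffOn ℝ ∞ B U
  injective_B : ∀ x ∈ U, Function.Injective (B x)
  A_eq_zero_iff : ∀ x ∈ U, ∀ v, A x v = 0 ↔ ∃ k, B x k = v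
  tangentConeAt_eq : ∀ x ∈ U, tangentConeAt ℝ (eqvClass R x) x = {v | A x v = 0}

/-- Completing `A x` by a fixed projection `P` onto `K = ker (A x₀)` gives `T x = (A x, P)`,
invertible at `x₀` and hence nearby; `T x` inverse restricted to `0 × K` frames `ker (A x)`. -/
lemma IsClosedSubmersive.exists_localFrame {R : Setoid E} (hR : IsClosedSubmersive R) (x₀ : E) :
    ∃ (W : Submodule ℝ (E × E)) (K : Submodule ℝ E) (Φ : LocalFrame R W K), x₀ ∈ Φ.U := by
  obtain ⟨W, Ω, F, hΩ, hx₀, hF, hgraph, hsurj⟩ :=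
    hR.submanifold.exists_submersion (x := (x₀, x₀)) (R.refl x₀)
  have hFat : ∀ z ∈ Ω, ContDiffAt ℝ ∞ F z := fun z hz => hF.contDiffAt (hΩ.mem_nhds hz)
  let A : E → E →L[ℝ] W := fun x => (fderiv ℝ F (x, x)).comp (ContinuousLinearMap.inr ℝ E E)
  have hdiag : Continuous fun x : E => (x, x) := continuous_id.prodMk continuous_id
  have hU₁ : IsOpen ((fun x : E => (x, x)) ⁻¹' Ω) := hΩ.preimage hdiag
  have hA : ContDiffOn ℝ ∞ A ((fun x : E => (x, x)) ⁻¹' Ω) := by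
    have h1 : ContDiffOn ℝ ∞ (fderiv ℝ F) Ω := hF.fderiv_of_isOpen hΩ (by simp)
    have h2 : ContDiffOn ℝ ∞ (fun x : E => fderiv ℝ F (x, x)) ((fun x : E => (x, x)) ⁻¹' Ω) :=
      h1.comp (contDiff_id.prodMk contDiff_id).contDiffOn fun x hx => hx
    exact h2.clm_comp contDiffOn_const
  have hAsurj : ∀ x, (x, x) ∈ Ω → Function.Surjective (A x) := by
    intro x hx w
    obtain ⟨⟨u, v⟩, huv⟩ := hsurj _ hx w
    have hT : ∀ t, t ∈ tangentSpace (graph R) (x, x) ↔ fderiv ℝ F (x, x) t = 0 := fun t =>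
      mem_tangentSpace_of_tangentConeAt_eq (tangentConeAt_eq_ker (hFat _ hx) (hsurj _ hx)
        ((hgraph _ hx).1 (R.refl x)) (by
          filter_upwards [hΩ.mem_nhds hx] with z hz using hgraph z hz))
    have hsub : u ∈ Submodule.map (fderiv ℝ (Prod.fst : E × E → E) (x, x) : E × E →ₗ[ℝ] E)
        (tangentSpace (graph R) (x, x)) := by
      rw [hR.submersive (x, x) (R.refl x)]
      trivial
    -- By submersivity some tangent vector of `R` has first component `u`; subtracting it from `(u,
    -- v)` leaves a vertical vector with the same image `w`.
    obtain ⟨⟨u', v'⟩, h1, h2⟩ := hsub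
    rw [fderiv_fst] at h2
    have h2' : u' = u := h2
    subst h2'
    refine ⟨v - v', ?_⟩
    have h3 := (hT _).1 h1
    have h4 : A x (v - v') = fderiv ℝ F (x, x) ((u', v) - (u', v')) := by
      simp [A]
    rw [h4, map_sub, h3, huv, sub_zero]
  let K : Submodule ℝ E := LinearMap.ker (A x₀ : E →ₗ[ℝ] W)
  obtain ⟨P, hP⟩ := (K.subtype).exists_leftInverse_of_injective K.ker_subtype
  have hP' : ∀ k : K, P k = k := fun k => LinearMap.congr_fun hP k
  let Pc : E →L[ℝ] K := LinearMap.toContinuousLinearMap P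
  let T : E → E →L[ℝ] W × K := fun x => (A x).prod Pc
  have hT₀ : Function.Bijective (T x₀) := by
    constructor
    · rw [injective_iff_map_eq_zero]
      intro v hv
      have h1 : A x₀ v = 0 := congrArg Prod.fst hv
      have h2 : P v = 0 := congrArg Prod.snd hv
      have := hP' ⟨v, h1⟩
      rw [show P ((⟨v, h1⟩ : K) : E) = P v from rfl, h2] at this
      exact (congrArg Subtype.val this).symm
    · rintro ⟨w, k⟩
      obtain ⟨v, rfl⟩ := hAsurj x₀ hx₀ w
      have hk : ∀ k : K, A x₀ k = 0 := fun k => k.2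
      refine ⟨v + ((k - P v : K) : E), Prod.ext ?_ ?_⟩
      · change A x₀ _ = A x₀ v
        rw [map_add, hk, add_zero]
      · change P _ = k
        rw [map_add, hP']
        abel
  let e₀ : E ≃L[ℝ] W × K := ContinuousLinearEquiv.ofBijective (T x₀)
    (LinearMap.ker_eq_bot.2 hT₀.1) (LinearMap.range_eq_top.2 hT₀.2)
  have he₀ : (e₀ : E →L[ℝ] W × K) = T x₀ := ContinuousLinearEquiv.coe_ofBijective _ _ _
  have hT : ContDiffOn ℝ ∞ T ((fun x : E => (x, x)) ⁻¹' Ω) := by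
    have h1 : T = fun x => (ContinuousLinearMap.inl ℝ W K).comp (A x) +
        (ContinuousLinearMap.inr ℝ W K).comp Pc := by
      ext x v <;> simp [T]
    rw [h1]
    exact (contDiffOn_const.clm_comp hA).add contDiffOn_const
  let U : Set E := (fun x : E => (x, x)) ⁻¹' Ω ∩
    T ⁻¹' Set.range ((↑) : (E ≃L[ℝ] W × K) → (E →L[ℝ] W × K))
  have hU : IsOpen U := hT.continuousOn.isOpen_inter_preimage hU₁ ContinuousLinearEquiv.isOpen
  -- `ContinuousLinearMap.inverse` is zero at non-invertible maps; only its values on `U` matter.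
  let B : E → K →L[ℝ] E := fun x =>
    (ContinuousLinearMap.inverse (T x)).comp (ContinuousLinearMap.inr ℝ W K)
  have hB : ContDiffOn ℝ ∞ B U := by
    intro x hx
    obtain ⟨e, he⟩ := hx.2
    have h1 : ContDiffAt ℝ ∞ T x := hT.contDiffAt (hU₁.mem_nhds hx.1)
    have h2 : ContDiffAt ℝ ∞ ContinuousLinearMap.inverse (T x) := by
      rw [← he]; exact contDiffAt_map_inverse e
    exact ((h2.comp x h1).clm_comp contDiffAt_const).contDiffWithinAt
  have hTB : ∀ x ∈ U, ∀ k, T x (B x k) = (0, k) := by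
    intro x hx k
    obtain ⟨e, he⟩ := hx.2
    have : B x k = e.symm (0, k) := by
      simp only [B]
      rw [← he, ContinuousLinearMap.inverse_equiv]
      rfl
    rw [this, ← he]
    exact e.apply_symm_apply _
  have hTinj : ∀ x ∈ U, Function.Injective (T x) := by
    intro x hx
    obtain ⟨e, he⟩ := hx.2
    rw [← he]
    exact e.injective
  refine ⟨W, K, ⟨U, Ω, F, A, B, hU, hΩ, fun x hx => hx.1, hF, hgraph, fun x v => rfl,
    hA.mono Set.inter_subset_left, fun x hx => hAsurj x hx.1, hB, ?_, ?_, ?_⟩, hx₀, e₀, he₀⟩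
  · intro x hx k k' hk
    have := congrArg (T x) hk
    rw [hTB x hx, hTB x hx] at this
    exact congrArg Prod.snd this
  · intro x hx v
    constructor
    · intro hv
      refine ⟨P v, hTinj x hx ?_⟩
      rw [hTB x hx]
      exact Prod.ext hv.symm rfl
    · rintro ⟨k, rfl⟩
      exact congrArg Prod.fst (hTB x hx k)
  · intro x hx
    have hin : HasFDerivAt (fun y : E => (x, y)) (ContinuousLinearMap.inr ℝ E E) x :=
      hasFDerivAt_prodMk_right x x
    have hd : HasFDerivAt (fun y => F (x, y)) (A x) x :=
      ((hFat _ hx.1).differentiableAt (by simp)).hasFDerivAt.comp x hin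
    have := tangentConeAt_eq_ker (M := eqvClass R x) (f := fun y => F (x, y)) (x := x)
      ((hFat _ hx.1).comp x (contDiffAt_const.prodMk contDiffAt_id))
      (by rw [hd.fderiv]; exact hAsurj x hx.1) ((hgraph _ hx.1).1 (R.refl x)) (by
        have hc : ContinuousAt (fun y : E => (x, y)) x := hin.continuousAt
        filter_upwards [hc (hΩ.mem_nhds hx.1)] with y hy using hgraph _ hy)
    rwa [hd.fderiv] at this

end Slices

/-! ### Regular points of normal maps and the slice property. -/

section NormalMaps

open Topology

variable {E : Type*} [NormedAddCommGroup E] [InnerProductSpace ℝ E] [FiniteDimensional ℝ E]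
  {W K : Type*} [NormedAddCommGroup W] [NormedSpace ℝ W] [FiniteDimensional ℝ W]
  [NormedAddCommGroup K] [NormedSpace ℝ K] [FiniteDimensional ℝ K]

omit [FiniteDimensional ℝ K] in
/-- Functionals on the source of an injective map are represented by vectors of the target. -/
lemma exists_innerSL_comp_eq {B : K →L[ℝ] E} (hB : Function.Injective B) (β : K →L[ℝ] ℝ) :
    ∃ w : E, (innerSL ℝ w).comp B = β := by
  obtain ⟨s, hs⟩ := (B : K →ₗ[ℝ] E).exists_leftInverse_of_injective (LinearMap.ker_eq_bot.2 hB)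
  refine ⟨(InnerProductSpace.toDual ℝ E).symm (β.comp (LinearMap.toContinuousLinearMap s)), ?_⟩
  ext k
  have : s (B k) = k := LinearMap.congr_fun hs k
  simp [this]

omit [FiniteDimensional ℝ E] in
lemma fderiv_normalMap_apply (w z : E × E) :
    fderiv ℝ (normalMap : E × E → E) w z = z.1 + z.2 := by
  have : HasFDerivAt (normalMap : E × E → E)
    (ContinuousLinearMap.fst ℝ E E + ContinuousLinearMap.snd ℝ E E) w :=
    hasFDerivAt_fst.add hasFDerivAt_snd
  rw [this.fderiv]
  rfl

namespace LocalFrame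

variable {R : Setoid E} (Φ : LocalFrame R W K) (p : E)

/-- The components of `p - x` along the class of `x`. -/
noncomputable def tangential (x : E) : K →L[ℝ] ℝ := (innerSL ℝ (p - x)).comp (Φ.B x)

/-- The local equations of the normal bundle of the class of `x`. -/
noncomputable def normalEquation (x : E) (z : E × E) : W × (K →L[ℝ] ℝ) :=
  (Φ.F (x, z.1), (innerSL ℝ z.2).comp (Φ.B z.1))

/-- The differential of the map `(F, tangential)` at `x`. -/
noncomputable def sliceDifferential (x : E) : E →L[ℝ] W × (K →L[ℝ] ℝ) :=
  (Φ.A x).prod (fderiv ℝ (Φ.tangential p) x)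

variable {p} {x : E}

omit [FiniteDimensional ℝ E] [FiniteDimensional ℝ W] [FiniteDimensional ℝ K] in
lemma mem_tangentSpace_eqvClass_iff (hx : x ∈ Φ.U) {v : E} :
    v ∈ tangentSpace (eqvClass R x) x ↔ Φ.A x v = 0 :=
  mem_tangentSpace_of_tangentConeAt_eq (Φ.tangentConeAt_eq x hx)

omit [FiniteDimensional ℝ E] [FiniteDimensional ℝ W] [FiniteDimensional ℝ K] in
lemma mem_orthogonal_iff (hx : x ∈ Φ.U) {w : E} :
    w ∈ (tangentSpace (eqvClass R x) x)ᗮ ↔ (innerSL ℝ w).comp (Φ.B x) = 0 := by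
  rw [Submodule.mem_orthogonal']
  constructor
  · intro h
    ext k
    exact h _ ((Φ.mem_tangentSpace_eqvClass_iff hx).2 ((Φ.A_eq_zero_iff x hx _).2 ⟨k, rfl⟩))
  · intro h v hv
    obtain ⟨k, rfl⟩ := (Φ.A_eq_zero_iff x hx _).1 ((Φ.mem_tangentSpace_eqvClass_iff hx).1 hv)
    exact DFunLike.congr_fun h k

-- If `z.1` is equivalent to `x`, both have the same class, so the frame at `z.1` spans the tangent
-- space of the class of `x` there.
omit [FiniteDimensional ℝ E] [FiniteDimensional ℝ W] [FiniteDimensional ℝ K] in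
lemma mem_normalBundle_iff {z : E × E} (hz : z.1 ∈ Φ.U) (hxz : (x, z.1) ∈ Φ.Ω) :
    z ∈ normalBundle (eqvClass R x) ↔ Φ.normalEquation x z = 0 := by
  rw [normalEquation, Prod.mk_eq_zero, ← Φ.mem_graph_iff _ hxz]
  constructor
  · rintro ⟨h1, h2⟩
    rw [eqvClass_eq h1, Φ.mem_orthogonal_iff hz] at h2
    exact ⟨h1, h2⟩
  · rintro ⟨h1, h2⟩
    refine ⟨h1, ?_⟩
    rw [eqvClass_eq h1, Φ.mem_orthogonal_iff hz]
    exact h2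

omit [FiniteDimensional ℝ E] [FiniteDimensional ℝ W] [FiniteDimensional ℝ K] in
lemma contDiffOn_tangential : ContDiffOn ℝ ∞ (Φ.tangential p) Φ.U :=
  (((innerSL ℝ).contDiff.comp (contDiff_const.sub contDiff_id)).contDiffOn).clm_comp
    Φ.contDiffOn_B

omit [FiniteDimensional ℝ E] [FiniteDimensional ℝ W] [FiniteDimensional ℝ K] in
lemma contDiffAt_normalEquation (hx : x ∈ Φ.U) (v : E) :
    ContDiffAt ℝ ∞ (Φ.normalEquation x) (x, v) := by
  have h1 : ContDiffAt ℝ ∞ Φ.F (x, x) :=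
    Φ.contDiffOn_F.contDiffAt (Φ.isOpen_Ω.mem_nhds (Φ.diag_mem x hx))
  have h2 : ContDiffAt ℝ ∞ Φ.B x := Φ.contDiffOn_B.contDiffAt (Φ.isOpen_U.mem_nhds hx)
  have h3 : ContDiffAt ℝ ∞ (fun z : E × E => Φ.F (x, z.1)) (x, v) :=
    ContDiffAt.comp (x, v) (f := fun z : E × E => (x, z.1)) h1
      (contDiffAt_const.prodMk contDiffAt_fst)
  have h4 : ContDiffAt ℝ ∞ (fun z : E × E => Φ.B z.1) (x, v) :=
    ContDiffAt.comp (x, v) (f := fun z : E × E => z.1) h2 contDiffAt_fst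
  have h5 : ContDiffAt ℝ ∞ (fun z : E × E => innerSL ℝ z.2) (x, v) :=
    (innerSL ℝ).contDiff.contDiffAt.comp (x, v) contDiffAt_snd
  exact h3.prodMk (h5.clm_comp h4)

omit [FiniteDimensional ℝ E] [FiniteDimensional ℝ W] [FiniteDimensional ℝ K] in
lemma hasFDerivAt_F_right (hx : x ∈ Φ.U) : HasFDerivAt (fun y => Φ.F (x, y)) (Φ.A x) x := by
  have h1 : DifferentiableAt ℝ Φ.F (x, x) :=
    (Φ.contDiffOn_F.contDiffAt (Φ.isOpen_Ω.mem_nhds (Φ.diag_mem x hx))).differentiableAt (by simp)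
  refine (h1.hasFDerivAt.comp x (hasFDerivAt_prodMk_right x x)).congr_fderiv ?_
  ext v
  simp [Φ.A_apply]

omit [FiniteDimensional ℝ E] [FiniteDimensional ℝ W] [FiniteDimensional ℝ K] in
lemma fderiv_normalEquation_fst (hx : x ∈ Φ.U) (v : E) (z : E × E) :
    (fderiv ℝ (Φ.normalEquation x) (x, v) z).1 = Φ.A x z.1 := by
  have h := ((Φ.contDiffAt_normalEquation hx v).differentiableAt (by simp)).hasFDerivAt.fst
  have h' : HasFDerivAt (fun z : E × E => Φ.F (x, z.1))
      ((Φ.A x).comp (ContinuousLinearMap.fst ℝ E E)) (x, v) :=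
    HasFDerivAt.comp (x, v) (f := fun z : E × E => z.1) (Φ.hasFDerivAt_F_right hx) hasFDerivAt_fst
  exact DFunLike.congr_fun (h.unique h') z

omit [FiniteDimensional ℝ E] [FiniteDimensional ℝ W] [FiniteDimensional ℝ K] in
lemma fderiv_normalEquation_vertical (hx : x ∈ Φ.U) (v w : E) :
    fderiv ℝ (Φ.normalEquation x) (x, v) (0, w) = (0, (innerSL ℝ w).comp (Φ.B x)) := by
  have h := ((Φ.contDiffAt_normalEquation hx v).differentiableAt (by simp)).hasFDerivAt.comp v
    (hasFDerivAt_prodMk_right x v)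
  have h1 : HasFDerivAt (fun u : E => (innerSL ℝ u).comp (Φ.B x))
      (((ContinuousLinearMap.compL ℝ K E ℝ).flip (Φ.B x)).comp (innerSL ℝ)) v :=
    (((ContinuousLinearMap.compL ℝ K E ℝ).flip (Φ.B x)).comp (innerSL ℝ)).hasFDerivAt
  have h' := (hasFDerivAt_const (Φ.F (x, x)) v).prodMk h1
  have := DFunLike.congr_fun (h.unique h') w
  simpa using this

-- Along `y ↦ (y, p - y)` the equation reads `(F (x, y), tangential p y)`, and the directions `(η,
-- -η)` form the kernel of `dν`.
omit [FiniteDimensional ℝ E] [FiniteDimensional ℝ W] [FiniteDimensional ℝ K] in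
lemma fderiv_normalEquation_antidiagonal (hx : x ∈ Φ.U) (η : E) :
    fderiv ℝ (Φ.normalEquation x) (x, p - x) (η, -η) = Φ.sliceDifferential p x η := by
  have hc : HasFDerivAt (fun y : E => (y, p - y))
      ((ContinuousLinearMap.id ℝ E).prod (-ContinuousLinearMap.id ℝ E)) x :=
    (hasFDerivAt_id x).prodMk ((hasFDerivAt_id x).const_sub p)
  have h := HasFDerivAt.comp x (f := fun y : E => (y, p - y))
    ((Φ.contDiffAt_normalEquation hx (p - x)).differentiableAt (by simp)).hasFDerivAt hc
  have h1 : HasFDerivAt (Φ.tangential p) (fderiv ℝ (Φ.tangential p) x) x :=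
    ((Φ.contDiffOn_tangential.contDiffAt (Φ.isOpen_U.mem_nhds hx)).differentiableAt
      (by simp)).hasFDerivAt
  have h' := (Φ.hasFDerivAt_F_right hx).prodMk h1
  have := DFunLike.congr_fun (h.unique h') η
  simpa [sliceDifferential] using this

-- `A x` reaches every first component; vertical vectors then correct the second freely, since `B x`
-- is injective.
omit [FiniteDimensional ℝ W] [FiniteDimensional ℝ K] in
lemma surjective_fderiv_normalEquation (hx : x ∈ Φ.U) (v : E) :
    Function.Surjective (fderiv ℝ (Φ.normalEquation x) (x, v)) := by
  rintro ⟨a, β⟩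
  obtain ⟨η, rfl⟩ := Φ.surjective_A x hx a
  obtain ⟨w, hw⟩ := exists_innerSL_comp_eq (Φ.injective_B x hx)
    (β - (fderiv ℝ (Φ.normalEquation x) (x, v) (η, 0)).2)
  refine ⟨(η, 0) + (0, w), ?_⟩
  rw [map_add, Φ.fderiv_normalEquation_vertical hx, hw]
  refine Prod.ext ?_ ?_
  · simp [Φ.fderiv_normalEquation_fst hx]
  · simp

lemma tangentConeAt_normalBundle (hx : x ∈ Φ.U) (h0 : Φ.tangential p x = 0) :
    tangentConeAt ℝ (normalBundle (eqvClass R x)) (x, p - x) =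
      {z | fderiv ℝ (Φ.normalEquation x) (x, p - x) z = 0} := by
  refine tangentConeAt_eq_ker (Φ.contDiffAt_normalEquation hx _)
    (Φ.surjective_fderiv_normalEquation hx _) ?_ ?_
  · exact Prod.ext ((Φ.mem_graph_iff _ (Φ.diag_mem x hx)).1 (R.refl x)) h0
  · have h1 : ∀ᶠ z : E × E in 𝓝 (x, p - x), z.1 ∈ Φ.U :=
      continuous_fst.continuousAt (Φ.isOpen_U.mem_nhds hx)
    have h2 : ∀ᶠ z : E × E in 𝓝 (x, p - x), (x, z.1) ∈ Φ.Ω :=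
      (continuous_const.prodMk continuous_fst).continuousAt
        (Φ.isOpen_Ω.mem_nhds (Φ.diag_mem x hx))
    filter_upwards [h1, h2] with z hz1 hz2 using Φ.mem_normalBundle_iff hz1 hz2

/-- Linear algebra: for the surjection `dG`, the restriction of `dν` to `ker dG` is onto iff that of
`dG` to `ker dν` is onto. -/
lemma isRegularPoint_iff (hx : x ∈ Φ.U) (h0 : Φ.tangential p x = 0) :
    IsRegularPoint normalMap (normalBundle (eqvClass R x)) (x, p - x) ↔
      Function.Surjective (Φ.sliceDifferential p x) := by
  have hT : ∀ z, z ∈ tangentSpace (normalBundle (eqvClass R x)) (x, p - x) ↔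
      fderiv ℝ (Φ.normalEquation x) (x, p - x) z = 0 := fun z =>
    mem_tangentSpace_of_tangentConeAt_eq (Φ.tangentConeAt_normalBundle hx h0)
  have hν := fderiv_normalMap_apply (x, p - x)
  rw [IsRegularPoint, Submodule.eq_top_iff']
  constructor
  · intro h t
    obtain ⟨⟨a, b⟩, rfl⟩ := Φ.surjective_fderiv_normalEquation hx (p - x) t
    obtain ⟨⟨c, d⟩, hcd, hsum⟩ := h (a + b)
    have hsum' : c + d = a + b := (hν (c, d)).symm.trans hsum
    refine ⟨a - c, ?_⟩
    rw [← Φ.fderiv_normalEquation_antidiagonal hx]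
    have : (a - c, -(a - c)) = (a, b) - (c, d) := by
      refine Prod.ext rfl ?_
      simp only [Prod.snd_sub]
      rw [neg_sub, sub_eq_sub_iff_add_eq_add, hsum', add_comm]
    rw [this, map_sub, (hT _).1 hcd, sub_zero]
  · intro h u
    obtain ⟨η, hη⟩ := h (fderiv ℝ (Φ.normalEquation x) (x, p - x) (u, 0))
    refine ⟨(u, 0) - (η, -η), (hT _).2 ?_, ?_⟩
    · rw [map_sub, Φ.fderiv_normalEquation_antidiagonal hx, hη, sub_self]
    · exact (hν _).trans (by simp)

lemma mem_normalsSlice_iff (hx : x ∈ Φ.U) : x ∈ normalsSlice R p ↔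
    Φ.tangential p x = 0 ∧ Function.Surjective (Φ.sliceDifferential p x) := by
  rw [normalsSlice, Set.mem_ofPred_eq, Φ.mem_orthogonal_iff hx]
  exact and_congr_right fun h => Φ.isRegularPoint_iff hx h

/-- Rank-nullity for `A x` gives `dim E = dim W + dim K`, so source and target have equal dimension.
-/
lemma bijective_sliceDifferential (hx : x ∈ Φ.U)
    (h : Function.Surjective (Φ.sliceDifferential p x)) :
    Function.Bijective (Φ.sliceDifferential p x) := by
  refine ⟨?_, h⟩
  have h1 := LinearMap.finrank_range_add_finrank_ker (Φ.A x : E →ₗ[ℝ] W)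
  have h2 : LinearMap.ker (Φ.A x : E →ₗ[ℝ] W) = LinearMap.range (Φ.B x : K →ₗ[ℝ] E) := by
    ext v
    exact Φ.A_eq_zero_iff x hx v
  rw [LinearMap.range_eq_top.2 (Φ.surjective_A x hx), finrank_top, h2,
    LinearMap.finrank_range_of_inj (Φ.injective_B x hx)] at h1
  have h3 : Module.finrank ℝ (K →L[ℝ] ℝ) = Module.finrank ℝ K := by
    rw [← LinearEquiv.finrank_eq (LinearMap.toContinuousLinearMap (𝕜 := ℝ) (E := K) (F' := ℝ))]
    exact Subspace.dual_finrank_eq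
  have h4 : Module.finrank ℝ E = Module.finrank ℝ (W × (K →L[ℝ] ℝ)) := by
    rw [Module.finrank_prod, h3, h1]
  exact (LinearMap.injective_iff_surjective_of_finrank_eq_finrank h4
    (f := (Φ.sliceDifferential p x : E →ₗ[ℝ] W × (K →L[ℝ] ℝ)))).2 h

/-- The two spaces are the kernels of the two components of a bijection onto a product. -/
lemma isCompl_tangentSpaces (hx : x ∈ Φ.U) (hx' : x ∈ normalsSlice R p)
    (hV : tangentConeAt ℝ (normalsSlice R p) x = {v | fderiv ℝ (Φ.tangential p) x v = 0}) :
    IsCompl (tangentSpace (normalsSlice R p) x) (tangentSpace (eqvClass R x) x) := by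
  have hs := ((Φ.mem_normalsSlice_iff hx).1 hx').2
  have hb := Φ.bijective_sliceDifferential hx hs
  have hV' : ∀ v, v ∈ tangentSpace (normalsSlice R p) x ↔ fderiv ℝ (Φ.tangential p) x v = 0 :=
    fun v => mem_tangentSpace_of_tangentConeAt_eq hV
  refine ⟨Submodule.disjoint_def.2 fun v h1 h2 => hb.1 ?_, ?_⟩
  · rw [map_zero]
    exact Prod.ext ((Φ.mem_tangentSpace_eqvClass_iff hx).1 h2) ((hV' v).1 h1)
  · rw [codisjoint_iff, Submodule.eq_top_iff']
    intro v
    obtain ⟨u, hu⟩ := hs (Φ.A x v, 0)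
    have hu1 : Φ.A x u = Φ.A x v := congrArg Prod.fst hu
    have hu2 : fderiv ℝ (Φ.tangential p) x u = 0 := congrArg Prod.snd hu
    refine Submodule.mem_sup.2 ⟨u, (hV' u).2 hu2, v - u,
      (Φ.mem_tangentSpace_eqvClass_iff hx).2 ?_, by abel⟩
    rw [map_sub, hu1, sub_self]

/-- Near a point of `V(R, p)`, the set `V(R, p)` is a regular level set. -/
lemma exists_nhd_normalsSlice (hx : x ∈ Φ.U) (hx' : x ∈ normalsSlice R p) :
    ∃ U : Set E, IsOpen U ∧ x ∈ U ∧ U ⊆ Φ.U ∧ ∀ y ∈ U, y ∈ normalsSlice R p ↔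
      Φ.tangential p y = 0 := by
  have hs := ((Φ.mem_normalsSlice_iff hx).1 hx').2
  have hb := Φ.bijective_sliceDifferential hx hs
  have hc : ContinuousOn (Φ.sliceDifferential p) Φ.U := by
    have h1 : ContinuousOn (fderiv ℝ (Φ.tangential p)) Φ.U :=
      Φ.contDiffOn_tangential.continuousOn_fderiv_of_isOpen Φ.isOpen_U (by simp)
    have h2 : Φ.sliceDifferential p = fun x =>
        (ContinuousLinearMap.inl ℝ W (K →L[ℝ] ℝ)).comp (Φ.A x) +
        (ContinuousLinearMap.inr ℝ W (K →L[ℝ] ℝ)).comp (fderiv ℝ (Φ.tangential p) x) := by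
      ext x v <;> simp [sliceDifferential]
    rw [h2]
    exact (continuousOn_const.clm_comp Φ.contDiffOn_A.continuousOn).add
      (continuousOn_const.clm_comp h1)
  -- Invertibility at `x` persists nearby, so there only the equation `tangential p y = 0` remains.
  let e : E ≃L[ℝ] W × (K →L[ℝ] ℝ) := ContinuousLinearEquiv.ofBijective (Φ.sliceDifferential p x)
    (LinearMap.ker_eq_bot.2 hb.1) (LinearMap.range_eq_top.2 hb.2)
  refine ⟨Φ.U ∩ Φ.sliceDifferential p ⁻¹' Set.range ((↑) : (E ≃L[ℝ] W × (K →L[ℝ] ℝ)) →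
    (E →L[ℝ] W × (K →L[ℝ] ℝ))), hc.isOpen_inter_preimage Φ.isOpen_U ContinuousLinearEquiv.isOpen,
    ⟨hx, e, ContinuousLinearEquiv.coe_ofBijective _ _ _⟩, Set.inter_subset_left, ?_⟩
  rintro y ⟨hy, e', he'⟩
  rw [Φ.mem_normalsSlice_iff hy, and_iff_left]
  rw [← he']
  exact e'.surjective

end LocalFrame

/-- The set `V(R, p)` is an étale slice. -/
theorem isEtaleSlice_normalsSlice {R : Setoid E} (hR : IsClosedSubmersive R) (p : E) :
    IsEtaleSlice R (normalsSlice R p) := by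
  have hsub : IsSmoothSubmanifold (normalsSlice R p) := by
    intro x hx
    obtain ⟨W, K, Φ, hxU⟩ := hR.exists_localFrame x
    obtain ⟨U, hU, hxU', hUU, hUV⟩ := Φ.exists_nhd_normalsSlice hxU hx
    refine exists_chart_of_submersion hU hxU' (Φ.contDiffOn_tangential.mono hUU) hUV fun β => ?_
    obtain ⟨v, hv⟩ := ((Φ.mem_normalsSlice_iff hxU).1 hx).2 (0, β)
    exact ⟨v, congrArg Prod.snd hv⟩
  refine ⟨hsub.isLocallyClosed, hsub, fun x hx => ?_⟩
  obtain ⟨W, K, Φ, hxU⟩ := hR.exists_localFrame x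
  obtain ⟨U, hU, hxU', hUU, hUV⟩ := Φ.exists_nhd_normalsSlice hxU hx
  refine Φ.isCompl_tangentSpaces hxU hx (tangentConeAt_eq_ker
    (Φ.contDiffOn_tangential.contDiffAt (Φ.isOpen_U.mem_nhds hxU)) (fun β => ?_)
    ((hUV x hxU').1 hx) ?_)
  · obtain ⟨v, hv⟩ := ((Φ.mem_normalsSlice_iff hxU).1 hx).2 (0, β)
    exact ⟨v, congrArg Prod.snd hv⟩
  · filter_upwards [hU.mem_nhds hxU'] with y hy using hUV y hy

/-- The tangent spaces of the classes are the tangent cones. -/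
lemma IsClosedSubmersive.mem_tangentSpace_iff {R : Setoid E} (hR : IsClosedSubmersive R) {x v : E} :
    v ∈ tangentSpace (eqvClass R x) x ↔ v ∈ tangentConeAt ℝ (eqvClass R x) x := by
  obtain ⟨W, K, Φ, hx⟩ := hR.exists_localFrame x
  rw [Φ.mem_tangentSpace_eqvClass_iff hx, Φ.tangentConeAt_eq x hx]
  rfl

/-- Removes the linear span, so that membership becomes a first-order condition. -/
lemma IsClosedSubmersive.mem_tangentSpace_normalBundle_iff {R : Setoid E}
    (hR : IsClosedSubmersive R) {x p : E} (h : p - x ∈ (tangentSpace (eqvClass R x) x)ᗮ)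
    {z : E × E} : z ∈ tangentSpace (normalBundle (eqvClass R x)) (x, p - x) ↔
      z ∈ tangentConeAt ℝ (normalBundle (eqvClass R x)) (x, p - x) := by
  obtain ⟨W, K, Φ, hx⟩ := hR.exists_localFrame x
  have h0 : Φ.tangential p x = 0 := (Φ.mem_orthogonal_iff hx).1 h
  rw [mem_tangentSpace_of_tangentConeAt_eq (Φ.tangentConeAt_normalBundle hx h0),
    Φ.tangentConeAt_normalBundle hx h0]
  rfl

end NormalMaps

/-! ### Semialgebraic families of tangent cones. -/

section TangentCones

open Topology

/-- This form has only real and vector quantifiers; taking `ε = 1 / (n + 1)` recovers defining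
sequences. -/
lemma mem_tangentConeAt_iff_forall_exists {F : Type*} [NormedAddCommGroup F] [NormedSpace ℝ F]
    {M : Set F} {x v : F} : v ∈ tangentConeAt ℝ M x ↔
      ∀ ε : ℝ, 0 < ε → ∃ (c : ℝ) (y : F), y ∈ M ∧ ‖y - x‖ < ε ∧ ‖c • (y - x) - v‖ < ε := by
  constructor
  · intro h ε hε
    obtain ⟨α, l, hl, c, d, hd, hdM, hcd⟩ := exists_fun_of_mem_tangentConeAt h
    obtain ⟨n, h1, h2, h3⟩ := (hdM.and ((hd.eventually (Metric.ball_mem_nhds 0 hε)).and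
      (hcd.eventually (Metric.ball_mem_nhds v hε)))).exists
    refine ⟨c n, x + d n, h1, ?_, ?_⟩
    · simpa using h2
    · simpa [dist_eq_norm] using h3
  · intro h
    choose! c y hyM h1 h2 using fun n : ℕ => h (1 / ((n : ℝ) + 1)) Nat.one_div_pos_of_nat
    have h0 := tendsto_one_div_add_atTop_nhds_zero_nat (𝕜 := ℝ)
    refine mem_tangentConeAt_of_seq Filter.atTop c (fun n => y n - x) ?_
      (.of_forall fun n => by simpa using hyM n) ?_
    · exact squeeze_zero_norm (fun n => (h1 n).le) h0
    · rw [tendsto_iff_norm_sub_tendsto_zero]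
      exact squeeze_zero (fun n => norm_nonneg _) (fun n => (h2 n).le) h0

variable {D F : Type*} [AddCommGroup D] [Module ℝ D]

/-- The norm is not polynomial, but its square is, and comparing squares suffices once `z.2` is
positive. -/
lemma semialg_norm_lt {E : Type*} [NormedAddCommGroup E] [InnerProductSpace ℝ E]
    [FiniteDimensional ℝ E] : Semialg {z : E × ℝ | ‖z.1‖ < z.2} := by
  have h : IsPolyMap fun z : E × ℝ => (inner ℝ z.1 z.1 : ℝ) :=
    isPolyMap_id.fst.inner isPolyMap_id.fst
  have h' : IsPolyMap fun z : E × ℝ => z.2 * z.2 := isPolyMap_id.snd.smul isPolyMap_id.snd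
  convert ((isPolyMap_const (D := E × ℝ) (0 : ℝ)).semialg_lt isPolyMap_id.snd).and
    (h.semialg_lt h') using 1
  ext z
  simp only [Set.mem_ofPred_eq, real_inner_self_eq_norm_mul_norm]
  constructor
  · intro hz
    exact ⟨(norm_nonneg _).trans_lt hz, mul_self_lt_mul_self (norm_nonneg _) hz⟩
  · rintro ⟨h1, h2⟩
    exact lt_of_mul_self_lt_mul_self₀ h1.le h2

lemma semialg_norm_prod_lt {E : Type*} [NormedAddCommGroup E] [InnerProductSpace ℝ E]
    [FiniteDimensional ℝ E] : Semialg {z : (E × E) × ℝ | ‖z.1‖ < z.2} := by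
  have h1 := (semialg_norm_lt (E := E)).preimage
    (isPolyMap_id (D := (E × E) × ℝ).fst.fst.prodMk isPolyMap_id.snd)
  have h2 := (semialg_norm_lt (E := E)).preimage
    (isPolyMap_id (D := (E × E) × ℝ).fst.snd.prodMk isPolyMap_id.snd)
  convert h1.inter h2 using 1
  ext z
  simp [Prod.norm_def]

/-- The tangent cones in a semialgebraic family form a semialgebraic family. -/
lemma semialg_tangentConeAt [NormedAddCommGroup F] [NormedSpace ℝ F] [FiniteDimensional ℝ F]
    (hF : Semialg {z : F × ℝ | ‖z.1‖ < z.2}) {S : Set (D × F)} (hS : Semialg S) {φ : D → F}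
    (hφ : IsPolyMap φ) :
    Semialg {z : D × F | z.2 ∈ tangentConeAt ℝ {y | (z.1, y) ∈ S} (φ z.1)} := by
  simp only [mem_tangentConeAt_iff_forall_exists]
  -- The factors after `D × F` carry the bound variables `ε`, `c`, `y`, eliminated from the
  -- innermost outwards.
  have hid : IsPolyMap fun w : (((D × F) × ℝ) × ℝ) × F => w := isPolyMap_id
  have hd := hid.fst.fst.fst.fst
  have hv := hid.fst.fst.fst.snd
  have hε := hid.fst.fst.snd
  have hc := hid.fst.snd
  have hy := hid.snd
  have h1 := hS.preimage (hd.prodMk hy)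
  have h2 := hF.preimage ((hy.sub (hφ.comp hd)).prodMk hε)
  have h3 := hF.preimage (((hc.smul (hy.sub (hφ.comp hd))).sub hv).prodMk hε)
  have h4 := Semialg.exists (p := fun (w : ((D × F) × ℝ) × ℝ) (y : F) => (w.1.1.1, y) ∈ S ∧
    ‖y - φ w.1.1.1‖ < w.1.2 ∧ ‖w.2 • (y - φ w.1.1.1) - w.1.1.2‖ < w.1.2) (h1.and (h2.and h3))
  have h5 := Semialg.exists (p := fun (w : (D × F) × ℝ) (c : ℝ) => ∃ y : F, (w.1.1, y) ∈ S ∧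
    ‖y - φ w.1.1‖ < w.2 ∧ ‖c • (y - φ w.1.1) - w.1.2‖ < w.2) h4
  have h6 := (isPolyMap_const (D := (D × F) × ℝ) (0 : ℝ)).semialg_lt isPolyMap_id.snd
  exact Semialg.forall (p := fun (w : D × F) (ε : ℝ) => 0 < ε → ∃ (c : ℝ) (y : F), (w.1, y) ∈ S ∧
    ‖y - φ w.1‖ < ε ∧ ‖c • (y - φ w.1) - w.2‖ < ε) (h6.imp h5)

end TangentCones

/-! ### Semialgebraicity of `V(R, p)`. -/

section SemialgebraicSlices

variable {E : Type*} [NormedAddCommGroup E] [InnerProductSpace ℝ E] [FiniteDimensional ℝ E]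

variable {R : Setoid E}

lemma semialg_tangentSpace_eqvClass (hR : IsClosedSubmersive R) (hS : Semialg (graph R)) :
    Semialg {z : E × E | z.2 ∈ tangentSpace (eqvClass R z.1) z.1} := by
  have h := semialg_tangentConeAt (φ := fun x : E => x) semialg_norm_lt hS isPolyMap_id
  convert h using 1
  ext z
  exact hR.mem_tangentSpace_iff

lemma semialg_normalBundle_eqvClass (hR : IsClosedSubmersive R) (hS : Semialg (graph R)) :
    Semialg {z : E × (E × E) | z.2 ∈ normalBundle (eqvClass R z.1)} := by
  have hid : IsPolyMap fun w : E × (E × E) => w := isPolyMap_id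
  have hid' : IsPolyMap fun w : (E × (E × E)) × E => w := isPolyMap_id
  have h1 := hS.preimage (hid.fst.prodMk hid.snd.fst)
  have h2 := (semialg_tangentSpace_eqvClass hR hS).preimage (hid'.fst.snd.fst.prodMk hid'.snd)
  have h3 := (hid'.snd.inner hid'.fst.snd.snd).semialg_eq (isPolyMap_const 0)
  have h4 := Semialg.forall (p := fun (w : E × (E × E)) (u : E) =>
    u ∈ tangentSpace (eqvClass R w.2.1) w.2.1 → (inner ℝ u w.2.2 : ℝ) = 0) (h2.imp h3)
  convert h1.inter h4 using 1
  ext z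
  change (R z.1 z.2.1 ∧ _) ↔ (R z.1 z.2.1 ∧ _)
  rw [Submodule.mem_orthogonal]
  refine and_congr_right fun h => ?_
  rw [eqvClass_eq h]
  exact Iff.rfl

lemma semialg_tangentConeAt_normalBundle (hR : IsClosedSubmersive R) (hS : Semialg (graph R))
    (p : E) : Semialg {z : E × (E × E) |
      z.2 ∈ tangentConeAt ℝ (normalBundle (eqvClass R z.1)) (z.1, p - z.1)} := by
  have hφ : IsPolyMap fun x : E => (x, p - x) :=
    (isPolyMap_id (D := E)).prodMk ((isPolyMap_const p).sub isPolyMap_id)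
  have hn := semialg_norm_prod_lt (E := E)
  have hN := semialg_normalBundle_eqvClass hR hS
  have h := semialg_tangentConeAt hn hN hφ
  exact h

/-- As `dν (a, b) = a + b`, the preimages of `u` are the pairs `(a, u - a)`; surjectivity thus
becomes a formula with quantifiers over `E`. -/
lemma mem_normalsSlice_iff_tangentConeAt (hR : IsClosedSubmersive R) {p x : E} :
    x ∈ normalsSlice R p ↔ (∀ u : E, u ∈ tangentSpace (eqvClass R x) x →
      (inner ℝ u (p - x) : ℝ) = 0) ∧ ∀ u : E, ∃ a : E, (a, u - a) ∈
        tangentConeAt ℝ (normalBundle (eqvClass R x)) (x, p - x) := by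
  rw [normalsSlice, Set.mem_ofPred_eq, ← Submodule.mem_orthogonal]
  refine and_congr_right fun h => ?_
  have hν := fderiv_normalMap_apply (x, p - x)
  rw [IsRegularPoint, Submodule.eq_top_iff']
  refine forall_congr' fun u => ?_
  constructor
  · rintro ⟨⟨a, b⟩, hab, hu⟩
    have hu' : a + b = u := (hν _).symm.trans hu
    refine ⟨a, ?_⟩
    rw [← hu', add_sub_cancel_left]
    exact (hR.mem_tangentSpace_normalBundle_iff h).1 hab
  · rintro ⟨a, ha⟩
    exact ⟨_, (hR.mem_tangentSpace_normalBundle_iff h).2 ha, (hν _).trans (by simp)⟩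

/-- If `R` is semialgebraic, so is `V(R, p)`. -/
theorem semialg_normalsSlice (hR : IsClosedSubmersive R) (hS : Semialg (graph R)) (p : E) :
    Semialg (normalsSlice R p) := by
  have hid : IsPolyMap fun w : E × E => w := isPolyMap_id
  have hid' : IsPolyMap fun w : (E × E) × E => w := isPolyMap_id
  have h1 := (hid.snd.inner ((isPolyMap_const p).sub hid.fst)).semialg_eq (isPolyMap_const 0)
  have h2 := (semialg_tangentConeAt_normalBundle hR hS p).preimage
    (hid'.fst.fst.prodMk (hid'.snd.prodMk (hid'.fst.snd.sub hid'.snd)))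
  have h3 := Semialg.exists (p := fun (w : E × E) (a : E) => (a, w.2 - a) ∈
    tangentConeAt ℝ (normalBundle (eqvClass R w.1)) (w.1, p - w.1)) h2
  have h4 := Semialg.forall (p := fun x u : E => u ∈ tangentSpace (eqvClass R x) x →
    (inner ℝ u (p - x) : ℝ) = 0) ((semialg_tangentSpace_eqvClass hR hS).imp h1)
  have h5 := Semialg.forall (p := fun x u : E => ∃ a : E,
    (a, u - a) ∈ tangentConeAt ℝ (normalBundle (eqvClass R x)) (x, p - x)) h3
  convert h4.inter h5 using 1
  ext x
  exact mem_normalsSlice_iff_tangentConeAt hR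

end SemialgebraicSlices

end NormalSlices

theorem mainTheorem4 (n : ℕ) (R : Setoid (EuclideanSpace ℝ (Fin n)))
    (hR : NormalSlices.IsClosedSubmersive R) (p : EuclideanSpace ℝ (Fin n)) :
    NormalSlices.IsEtaleSlice R (NormalSlices.normalsSlice R p) ∧
      (NormalSlices.IsSemialgebraic (NormalSlices.coords₂ (NormalSlices.graph R)) →
        NormalSlices.IsSemialgebraic (NormalSlices.coords (NormalSlices.normalsSlice R p))) :=
  ⟨NormalSlices.isEtaleSlice_normalsSlice hR p, fun h =>
    (NormalSlices.semialg_normalsSlice hR (NormalSlices.semialg_of_coords₂ h) p).coords⟩
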